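/- Let $B^2=\{z\in\mathbb{R}^2:|z|\le 1\}$ and $Q_1=x$, $Q_2=y$, $Q_3=x^2$, $Q_4=xy$. For $p\in\{1,2,3,4\}$ let $A_p=\operatorname{span}_{\mathbb R}\{1,Q_1,\dots,Q_p\}\setminus\{0\}$, and identify $\mathbb{RP}^p$ with the set of classes $[Q]$ of elements of $A_p$ modulo multiplication by nonzero real numbers. Let $F_p$ be the map that sends $[Q]$ to the real algebraic variety $\{Q=0\}$ restricted to $B^2$, considered as a one-dimensional relative mod $2$ cycle of $(B^2,\partial B^2)$; that is, $F_p([Q])$ is the relative mod $2$ boundary in $B^2$ of the region $\{Q<0\}$. Its mass $\|F_p([Q])\|$ is the length ($\mathcal H^1$-measure) of the set of points of the open disc at which neither $\{Q<0\}$ nor its complement has Lebesgue density zero. Then, for every $[Q]\in\mathbb{RP}^p$, $$\|F_p([Q])\|\le 2\quad\text{and}\quad \mathcal H^1(\{Q=0\}\cap B^2)\le 2\qquad\text{if } p=1,2,$$ $$\|F_p([Q])\|<4.002671\quad\text{and}\quad \mathcal H^1(\{Q=0\}\cap B^2)<4.002671\qquad\text{if } p=3,4.$$ -/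

import Mathlib

open MeasureTheory Filter Topology
open scoped ENNReal LinearAlgebra.Projectivization

namespace GuthSweepout

noncomputable section

/-- The Euclidean plane. -/
abbrev Plane : Type := EuclideanSpace ℝ (Fin 2)

/-- The closed unit disc `B²`. -/
def disc : Set Plane := Metric.closedBall 0 1

/-- The open unit disc `B² \ ∂B²`. -/
def openDisc : Set Plane := Metric.ball 0 1

/-- Length of a subset of the plane: its one-dimensional Hausdorff measure. -/
def length (S : Set Plane) : ℝ≥0∞ := μH[1] S

/-! ### Relative mod 2 cycles of dimension one in the disc -/

/-- The proportion of the ball of radius `r` about `z` that is filled by `E`. -/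
def ballRatio (E : Set Plane) (z : Plane) (r : ℝ) : ℝ≥0∞ :=
  volume (E ∩ Metric.ball z r) / volume (Metric.ball z r)

/-- `E` has Lebesgue density zero at `z`. -/
def HasDensityZero (E : Set Plane) (z : Plane) : Prop :=
  Tendsto (ballRatio E z) (𝓝[>] 0) (𝓝 0)

/-- The essential (measure-theoretic) boundary of `E`: the points at which neither `E` nor its
complement has density zero. By the theorems of De Giorgi and Federer, this is, up to a set of
length zero, the carrier of the mod 2 boundary `∂[E]`, and its length is the mass of `∂[E]`. -/
def essBoundary (E : Set Plane) : Set Plane :=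
  {z | ¬ HasDensityZero E z ∧ ¬ HasDensityZero Eᶜ z}

/-- A one-dimensional relative mod 2 cycle of the pair `(B², ∂B²)`. A rectifiable chain mod 2 is
recorded by the set that carries it, and a class modulo chains lying in `∂B²` by its canonical
representative, the one whose carrier avoids `∂B²`. Since `H₁(B², ∂B²; ℤ₂) = 0`, the relative
cycles are the relative boundaries of the two-dimensional mod 2 chains, that is, of measurable
regions (a mass in `[0, ∞]` is allowed here: finiteness is not built into the type). -/
structure RelCycle where
  /-- the carrier of the canonical representative -/
  carrier : Set Plane
  isRelBoundary : ∃ E : Set Plane, MeasurableSet E ∧ carrier = essBoundary E ∩ openDisc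

/-- The mass of a relative cycle: the length of the carrier of its canonical representative. -/
def RelCycle.mass (T : RelCycle) : ℝ≥0∞ := length T.carrier

/-- The relative cycle bounded by a measurable region. -/
def relBoundary (E : Set Plane) (hE : MeasurableSet E) : RelCycle :=
  ⟨essBoundary E ∩ openDisc, E, hE, rfl⟩

/-! ### The polynomials -/

/-- The monomials `Q₁ = x`, `Q₂ = y`, `Q₃ = x²`, `Q₄ = xy` (indexed from `0`). -/
def monomial : Fin 4 → Plane → ℝ :=
  ![fun z => z 0, fun z => z 1, fun z => z 0 ^ 2, fun z => z 0 * z 1]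

/-- The span of `1, Q₁, …, Q_p`, as a space of functions on the plane. -/
def polySpace (p : ℕ) : Submodule ℝ (Plane → ℝ) :=
  Submodule.span ℝ ({fun _ => 1} ∪ {f | ∃ i : Fin 4, (i : ℕ) < p ∧ f = monomial i})

/-- The real algebraic variety `Q = 0`, restricted to the closed disc. -/
def variety (Q : Plane → ℝ) : Set Plane := {z ∈ disc | Q z = 0}

theorem exists_coeffs {p : ℕ} {Q : Plane → ℝ} (hQ : Q ∈ polySpace p) :
    ∃ a b c d e : ℝ, ∀ z : Plane,
      Q z = a + b * z 0 + c * z 1 + d * z 0 ^ 2 + e * (z 0 * z 1) := by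
  induction hQ using Submodule.span_induction with
  | mem f hf =>
    rcases hf with hf | ⟨i, -, hf⟩
    · rw [Set.mem_singleton_iff] at hf
      exact ⟨1, 0, 0, 0, 0, fun z => by simp [hf]⟩
    · subst hf
      fin_cases i
      · exact ⟨0, 1, 0, 0, 0, fun z => by simp [monomial]⟩
      · exact ⟨0, 0, 1, 0, 0, fun z => by simp [monomial]⟩
      · exact ⟨0, 0, 0, 1, 0, fun z => by simp [monomial]⟩
      · exact ⟨0, 0, 0, 0, 1, fun z => by simp [monomial]⟩
  | zero => exact ⟨0, 0, 0, 0, 0, fun z => by simp⟩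
  | add f g _ _ hf hg =>
    obtain ⟨a, b, c, d, e, h⟩ := hf
    obtain ⟨a', b', c', d', e', h'⟩ := hg
    exact ⟨a + a', b + b', c + c', d + d', e + e', fun z => by
      rw [Pi.add_apply, h, h']; ring⟩
  | smul t f _ hf =>
    obtain ⟨a, b, c, d, e, h⟩ := hf
    exact ⟨t * a, t * b, t * c, t * d, t * e, fun z => by
      rw [Pi.smul_apply, h, smul_eq_mul]; ring⟩

theorem continuous_of_mem {p : ℕ} {Q : Plane → ℝ} (hQ : Q ∈ polySpace p) : Continuous Q := by
  obtain ⟨a, b, c, d, e, h⟩ := exists_coeffs hQ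
  rw [funext h]
  fun_prop

/-- A nonzero polynomial of the span vanishes only on a null set. -/
theorem volume_zeros {p : ℕ} {Q : Plane → ℝ} (hQ : Q ∈ polySpace p) (h0 : Q ≠ 0) :
    volume {z | Q z = 0} = 0 := by
  obtain ⟨a, b, c, d, e, h⟩ := exists_coeffs hQ
  let q : ℝ × ℝ → ℝ := fun w => a + b * w.1 + c * w.2 + d * w.1 ^ 2 + e * (w.1 * w.2)
  have hq : Continuous q := by fun_prop
  have hmeas : MeasurableSet {w | q w = 0} := (isClosed_singleton.preimage hq).measurableSet
  have mp := (volume_preserving_finTwoArrow ℝ).comp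
    (PiLp.volume_preserving_ofLp (Fin 2))
  have hset : {z : Plane | Q z = 0} =
      (MeasurableEquiv.finTwoArrow ∘ WithLp.ofLp) ⁻¹' {w | q w = 0} := by
    ext z
    simp [q, h, MeasurableEquiv.finTwoArrow]
  rw [hset, mp.measure_preimage hmeas.nullMeasurableSet, Measure.volume_eq_prod,
    Measure.measure_prod_null hmeas]
  by_cases hce : c = 0 ∧ e = 0
  · obtain ⟨rfl, rfl⟩ := hce
    let P : Polynomial ℝ := Polynomial.C a + Polynomial.C b * Polynomial.X
      + Polynomial.C d * Polynomial.X ^ 2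
    have hev : ∀ x, P.eval x = a + b * x + d * x ^ 2 := fun x => by simp [P]
    have hP : P ≠ 0 := by
      intro hP
      apply h0
      funext z
      have := hev (z 0)
      rw [hP, Polynomial.eval_zero] at this
      rw [h, Pi.zero_apply]
      linarith
    have hfin : {x | P.IsRoot x}.Finite := Polynomial.finite_setOfPred_isRoot hP
    have hae : ∀ᵐ x : ℝ, x ∉ {x | P.IsRoot x} := hfin.countable.ae_notMem volume
    filter_upwards [hae] with x hx
    have : Prod.mk x ⁻¹' {w | q w = 0} = ∅ := by
      ext y
      simp only [Set.mem_preimage, Set.mem_ofPred_eq, Set.mem_empty_iff_false, iff_false, q]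
      intro hy
      apply hx
      simp only [Polynomial.IsRoot, hev]
      linarith
    rw [this]; simp
  · have hsub : {x : ℝ | c + e * x = 0}.Subsingleton := by
      intro x hx y hy
      simp only [Set.mem_ofPred_eq] at hx hy
      have he : e ≠ 0 := by
        rintro rfl
        exact hce ⟨by linarith, rfl⟩
      exact mul_left_cancel₀ he (by linarith)
    have hae : ∀ᵐ x : ℝ, x ∉ {x : ℝ | c + e * x = 0} := hsub.countable.ae_notMem volume
    filter_upwards [hae] with x hx
    apply Set.Subsingleton.measure_zero
    intro y hy y' hy'
    simp only [Set.mem_preimage, Set.mem_ofPred_eq, q] at hy hy' hx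
    exact mul_left_cancel₀ hx (by linarith)

theorem measurableSet_neg {p : ℕ} {Q : Plane → ℝ} (hQ : Q ∈ polySpace p) :
    MeasurableSet {z | Q z < 0} :=
  (isOpen_lt (continuous_of_mem hQ) continuous_const).measurableSet

theorem hasDensityZero_congr {E E' : Set Plane} (h : E =ᵐ[volume] E') (z : Plane) :
    HasDensityZero E z ↔ HasDensityZero E' z := by
  have : ballRatio E z = ballRatio E' z := by
    funext r
    unfold ballRatio
    rw [measure_congr (h.inter (ae_eq_refl (Metric.ball z r)))]
  rw [HasDensityZero, HasDensityZero, this]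

theorem essBoundary_congr {E E' : Set Plane} (h : E =ᵐ[volume] E') :
    essBoundary E = essBoundary E' := by
  ext z
  simp only [essBoundary, Set.mem_ofPred_eq, hasDensityZero_congr h z,
    hasDensityZero_congr h.compl z]

theorem essBoundary_compl (E : Set Plane) : essBoundary Eᶜ = essBoundary E := by
  ext z
  simp only [essBoundary, Set.mem_ofPred_eq, compl_compl, and_comm]

/-- The region `Q < 0` has the same essential boundary for all nonzero multiples of `Q`. -/
theorem essBoundary_smul {p : ℕ} {Q : Plane → ℝ} (hQ : Q ∈ polySpace p) (h0 : Q ≠ 0)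
    {t : ℝ} (ht : t ≠ 0) :
    essBoundary {z | (t • Q) z < 0} = essBoundary {z | Q z < 0} := by
  rcases lt_or_gt_of_ne ht with ht | ht
  · rw [← essBoundary_compl {z | Q z < 0}]
    apply essBoundary_congr
    have hae : ∀ᵐ z : Plane, z ∉ {z | Q z = 0} :=
      measure_eq_zero_iff_ae_notMem.1 (volume_zeros hQ h0)
    refine Filter.eventuallyEq_set.2 ?_
    filter_upwards [hae] with z hz
    simp only [Set.mem_ofPred_eq, Pi.smul_apply, smul_eq_mul, Set.mem_compl_iff, not_lt] at hz ⊢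
    constructor
    · intro h
      by_contra! h'
      exact absurd (mul_pos_of_neg_of_neg ht h') (not_lt.2 h.le)
    · intro h
      exact mul_neg_of_neg_of_pos ht (lt_of_le_of_ne h (Ne.symm hz))
  · congr 1
    ext z
    simp only [Set.mem_ofPred_eq, Pi.smul_apply, smul_eq_mul]
    exact ⟨fun h => by
      by_contra! h'
      exact absurd (mul_nonneg ht.le h') (not_le.2 h), fun h => mul_neg_of_pos_of_neg ht h⟩

/-- The map `F_p` from the projective space of `span {1, Q₁, …, Q_p}` to relative mod 2 cycles. It
sends `[Q]` to the variety `Q = 0` in the disc, as a mod 2 cycle: the relative boundary of the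
region `Q < 0`, in which components along which `Q` vanishes to even order cancel. -/
def F (p : ℕ) : ℙ ℝ (polySpace p) → RelCycle :=
  Projectivization.lift
    (fun Q => relBoundary {z | (Q.1 : Plane → ℝ) z < 0} (measurableSet_neg Q.1.2))
    (by
      rintro ⟨Q, hQ⟩ ⟨R, hR⟩ t (rfl : Q = t • R)
      have ht : t ≠ 0 := by
        rintro rfl
        exact hQ (zero_smul ℝ R)
      have hR' : (R : Plane → ℝ) ≠ 0 := fun h => hR (Subtype.ext h)
      simp only [relBoundary, RelCycle.mk.injEq]
      exact congrArg (· ∩ openDisc) (essBoundary_smul R.2 hR' ht))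

end

end GuthSweepout

namespace GuthSweepout

/-! ### Upper bounds for the length of a parametrized curve -/

/-! The carrier of `F p [Q]` lies in the zero set, so it suffices to bound the length of the conic
in the disc. For `p ≤ 2` this is a chord. Otherwise there is no `y ^ 2` term, and the conic is
empty, one or two lines (total at most 4), a parabola, or a hyperbola `C + t • U + t⁻¹ • W`. On the
last two, membership in the disc is a quartic inequality in the parameter, so at most two arcs
remain (`quartic_nonpos_cases`).

One arc (`length_symmetric_arc_lt`): averaging the speeds at `s` and `-s` makes the oblique symmetry
orthogonal, and a hyperbolic arc is shorter than the parabolic arc around it. The worst case is a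
parabola with its vertex on the circle and its axis through the centre. Its length depends on one
parameter, and `parabolaArc_lt` bounds its maximum, the source of 4.002671.

Two arcs of a parabola (`integral_sqrt_add_integral_sqrt_lt`): averaging again makes the position
symmetric, and subadditivity of arc length reduces this to the one-arc bound; where the averaging
loses too much, Cauchy–Schwarz gives 4.

Two arcs on one branch of a hyperbola (`length_same_branch_lt`): the pencil of the hyperbola and the
circle contains a parabola through the same four points, with longer arcs.

Arcs on opposite branches (`length_opposite_branches_le`): together they are at most two chords,
hence at most 4. -/

theorem hausdorffMeasure_image_Icc_le {E : Type*} [MetricSpace E] [MeasurableSpace E]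
    [BorelSpace E] {γ : ℝ → E} {φ : ℝ → ℝ} {a b : ℝ}
    (h : ∀ s ∈ Set.Icc a b, ∀ t ∈ Set.Icc a b, s ≤ t → dist (γ s) (γ t) ≤ φ t - φ s) :
    μH[1] (γ '' Set.Icc a b) ≤ ENNReal.ofReal (φ b - φ a) := by
  rcases Set.eq_empty_or_nonempty (Set.Icc a b) with he | hne
  · simp [he]
  have hab : a ≤ b := Set.nonempty_Icc.1 hne
  have hdist : ∀ s ∈ Set.Icc a b, ∀ t ∈ Set.Icc a b, dist (γ s) (γ t) ≤ dist (φ s) (φ t) := by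
    intro s hs t ht
    rcases le_total s t with hst | hst
    · have := h s hs t ht hst
      rw [dist_comm (φ s), Real.dist_eq]
      exact this.trans (le_abs_self _)
    · have := h t ht s hs hst
      rw [dist_comm, Real.dist_eq]
      exact this.trans (le_abs_self _)
  have hchoose : ∀ u ∈ φ '' Set.Icc a b, ∃ s ∈ Set.Icc a b, φ s = u := fun u hu => hu
  choose! ψ hψ hφψ using hchoose
  -- `γ` factors through `φ`: it agrees at points with equal `φ`, so a section `ψ` of `φ` gives a
  -- 1-Lipschitz parametrization by a subset of the line. Continuity of `φ` is not needed.
  have hlip : LipschitzOnWith 1 (γ ∘ ψ) (φ '' Set.Icc a b) := by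
    refine LipschitzOnWith.of_dist_le_mul fun u hu v hv => ?_
    have := hdist _ (hψ u hu) _ (hψ v hv)
    rw [hφψ u hu, hφψ v hv] at this
    simpa using this
  have hsub : γ '' Set.Icc a b ⊆ (γ ∘ ψ) '' (φ '' Set.Icc a b) := by
    rintro _ ⟨s, hs, rfl⟩
    have hu : φ s ∈ φ '' Set.Icc a b := ⟨s, hs, rfl⟩
    refine ⟨φ s, hu, ?_⟩
    have := hdist _ (hψ _ hu) _ hs
    rw [hφψ _ hu, dist_self] at this
    exact dist_le_zero.1 this
  have hsub2 : φ '' Set.Icc a b ⊆ Set.Icc (φ a) (φ b) := by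
    rintro _ ⟨s, hs, rfl⟩
    have h1 := (dist_nonneg).trans (h a ⟨le_rfl, hab⟩ s hs hs.1)
    have h2 := (dist_nonneg).trans (h s hs b ⟨hab, le_rfl⟩ hs.2)
    exact ⟨by linarith, by linarith⟩
  calc μH[1] (γ '' Set.Icc a b) ≤ μH[1] ((γ ∘ ψ) '' (φ '' Set.Icc a b)) := measure_mono hsub
    _ ≤ (1 : NNReal) ^ (1 : ℝ) * μH[1] (φ '' Set.Icc a b) :=
        hlip.hausdorffMeasure_image_le zero_le_one
    _ = μH[1] (φ '' Set.Icc a b) := by simp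
    _ ≤ μH[1] (Set.Icc (φ a) (φ b)) := measure_mono hsub2
    _ = ENNReal.ofReal (φ b - φ a) := by
        rw [hausdorffMeasure_real, Real.volume_Icc]

theorem hausdorffMeasure_image_Icc_le_integral {E : Type*} [NormedAddCommGroup E]
    [NormedSpace ℝ E] [CompleteSpace E] [MeasurableSpace E] [BorelSpace E] {γ γ' : ℝ → E} {a b : ℝ}
    (hab : a ≤ b) (hγ : ∀ t ∈ Set.Icc a b, HasDerivAt γ (γ' t) t)
    (hc : ContinuousOn γ' (Set.Icc a b)) :
    μH[1] (γ '' Set.Icc a b) ≤ ENNReal.ofReal (∫ t in a..b, ‖γ' t‖) := by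
  have hint : ∀ s ∈ Set.Icc a b, ∀ t ∈ Set.Icc a b,
      IntervalIntegrable γ' volume s t := fun s hs t ht =>
    (hc.mono (Set.uIcc_subset_Icc hs ht)).intervalIntegrable
  have key := hausdorffMeasure_image_Icc_le (γ := γ) (a := a) (b := b)
    (φ := fun t => ∫ u in a..t, ‖γ' u‖) (fun s hs t ht hst => by
      have ha : a ∈ Set.Icc a b := ⟨le_rfl, hab⟩
      rw [intervalIntegral.integral_interval_sub_left (hint a ha t ht).norm (hint a ha s hs).norm,
        dist_comm, dist_eq_norm, ← intervalIntegral.integral_eq_sub_of_hasDerivAt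
          (fun u hu => hγ u (Set.uIcc_subset_Icc hs ht hu)) (hint s hs t ht)]
      exact intervalIntegral.norm_integral_le_integral_norm hst)
  simpa using key

/-! ### Comparison of lengths of nested convex graphs -/

/-- The convex function `v ↦ √(n ^ 2 + v ^ 2)` lies above its tangent lines; after clearing the
denominator this is Cauchy–Schwarz. -/
theorem sqrt_tangent_le {n v w : ℝ} (hn : 0 < n) :
    √(n ^ 2 + v ^ 2) + v / √(n ^ 2 + v ^ 2) * (w - v) ≤ √(n ^ 2 + w ^ 2) := by
  have h0 : 0 < √(n ^ 2 + v ^ 2) := Real.sqrt_pos.2 (by positivity)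
  have h1 : √(n ^ 2 + v ^ 2) ^ 2 = n ^ 2 + v ^ 2 := Real.sq_sqrt (by positivity)
  have h2 : √(n ^ 2 + w ^ 2) ^ 2 = n ^ 2 + w ^ 2 := Real.sq_sqrt (by positivity)
  have e : √(n ^ 2 + v ^ 2) + v / √(n ^ 2 + v ^ 2) * (w - v)
      = (n ^ 2 + v * w) / √(n ^ 2 + v ^ 2) := by
    field_simp
    rw [h1]; ring
  rw [e, div_le_iff₀ h0]
  refine abs_le_of_sq_le_sq' ?_ (by positivity) |>.2
  rw [mul_pow, h1, h2]
  nlinarith [mul_nonneg (sq_nonneg n) (sq_nonneg (v - w))]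

theorem hasDerivAt_div_sqrt {n : ℝ} (hn : 0 < n) (v : ℝ) :
    HasDerivAt (fun v => v / √(n ^ 2 + v ^ 2)) (n ^ 2 / √(n ^ 2 + v ^ 2) ^ 3) v := by
  have h0 : 0 < √(n ^ 2 + v ^ 2) := Real.sqrt_pos.2 (by positivity)
  have h1 : √(n ^ 2 + v ^ 2) ^ 2 = n ^ 2 + v ^ 2 := Real.sq_sqrt (by positivity)
  have hd : HasDerivAt (fun v : ℝ => n ^ 2 + v ^ 2) (2 * v) v := by
    simpa using (hasDerivAt_pow 2 v).const_add (n ^ 2)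
  have := (hasDerivAt_id v).div (hd.sqrt (by positivity)) h0.ne'
  refine this.congr_deriv ?_
  simp only [id]
  field_simp
  rw [h1]; ring

/-- Of two graphs with common endpoints, the upper one being convex, the upper one is shorter. -/
theorem integral_sqrt_le_of_convex {n a b : ℝ} {X X' X'' Y Y' : ℝ → ℝ} (hn : 0 < n) (hab : a ≤ b)
    (hX : ∀ t, HasDerivAt X (X' t) t) (hX' : ∀ t, HasDerivAt X' (X'' t) t)
    (hcX : Continuous X'') (hX'' : ∀ t, 0 ≤ X'' t)
    (hY : ∀ t, HasDerivAt Y (Y' t) t) (hcY : Continuous Y')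
    (hle : ∀ t ∈ Set.Icc a b, Y t ≤ X t) (ha : Y a = X a) (hb : Y b = X b) :
    ∫ t in a..b, √(n ^ 2 + X' t ^ 2) ≤ ∫ t in a..b, √(n ^ 2 + Y' t ^ 2) := by
  have hcX' : Continuous X' := continuous_iff_continuousAt.2 fun t => (hX' t).continuousAt
  have hcXY : Continuous fun t => Y t - X t := continuous_iff_continuousAt.2 fun t =>
    ((hY t).sub (hX t)).continuousAt
  have hpos : ∀ t, 0 < √(n ^ 2 + X' t ^ 2) := fun t => Real.sqrt_pos.2 (by positivity)
  have hc1 : Continuous fun t => X' t / √(n ^ 2 + X' t ^ 2) :=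
    hcX'.div (by fun_prop) fun t => (hpos t).ne'
  have hc2 : Continuous fun t => n ^ 2 / √(n ^ 2 + X' t ^ 2) ^ 3 * X'' t :=
    (continuous_const.div (by fun_prop) fun t => (pow_pos (hpos t) 3).ne').mul hcX
  -- The first variation of length from `X` towards `Y`. The boundary terms vanish, and after
  -- integration by parts the sign follows from `X'' ≥ 0` and `Y ≤ X`. Convexity of the integrand
  -- then passes from first variation to lengths.
  have parts := intervalIntegral.integral_mul_deriv_eq_deriv_mul (a := a) (b := b)
    (u := fun t => X' t / √(n ^ 2 + X' t ^ 2)) (v := fun t => Y t - X t)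
    (u' := fun t => n ^ 2 / √(n ^ 2 + X' t ^ 2) ^ 3 * X'' t) (v' := fun t => Y' t - X' t)
    (fun t _ => (hasDerivAt_div_sqrt hn (X' t)).comp t (hX' t))
    (fun t _ => (hY t).sub (hX t)) (hc2.intervalIntegrable _ _)
    ((hcY.sub hcX').intervalIntegrable _ _)
  have hneg : ∫ t in a..b, n ^ 2 / √(n ^ 2 + X' t ^ 2) ^ 3 * X'' t * (Y t - X t) ≤ 0 := by
    rw [← neg_nonneg, ← intervalIntegral.integral_neg]
    refine intervalIntegral.integral_nonneg hab fun t ht => ?_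
    have h1 : 0 ≤ n ^ 2 / √(n ^ 2 + X' t ^ 2) ^ 3 * X'' t :=
      mul_nonneg (div_nonneg (by positivity) (pow_pos (hpos t) 3).le) (hX'' t)
    nlinarith [hle t ht]
  simp only [ha, hb, sub_self, mul_zero, zero_sub] at parts
  have hle' : ∫ t in a..b, (√(n ^ 2 + X' t ^ 2) + X' t / √(n ^ 2 + X' t ^ 2) * (Y' t - X' t))
      ≤ ∫ t in a..b, √(n ^ 2 + Y' t ^ 2) :=
    intervalIntegral.integral_mono_on hab
      (((by fun_prop : Continuous fun t => √(n ^ 2 + X' t ^ 2)).add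
        (hc1.mul (hcY.sub hcX'))).intervalIntegrable _ _)
      ((by fun_prop : Continuous fun t => √(n ^ 2 + Y' t ^ 2)).intervalIntegrable _ _)
      fun t _ => sqrt_tangent_le hn
  have hc3 : Continuous fun t => X' t / √(n ^ 2 + X' t ^ 2) * (Y' t - X' t) :=
    hc1.mul (hcY.sub hcX')
  rw [intervalIntegral.integral_add
    ((by fun_prop : Continuous fun t => √(n ^ 2 + X' t ^ 2)).intervalIntegrable _ _)
    (hc3.intervalIntegrable _ _), parts] at hle'
  linarith

/-! ### Parabolic arcs -/

/-- Twice the length of the arc of the parabola `2 y = x ^ 2` between abscissas `0` and `σ`. -/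
noncomputable def parabolaArc (σ : ℝ) : ℝ := σ * √(1 + σ ^ 2) + Real.arsinh σ

theorem hasDerivAt_parabolaArc (σ : ℝ) : HasDerivAt parabolaArc (2 * √(1 + σ ^ 2)) σ := by
  have h0 : 0 < √(1 + σ ^ 2) := Real.sqrt_pos.2 (by positivity)
  have h1 : √(1 + σ ^ 2) ^ 2 = 1 + σ ^ 2 := Real.sq_sqrt (by positivity)
  have hd : HasDerivAt (fun v : ℝ => 1 + v ^ 2) (2 * σ) σ := by
    simpa using (hasDerivAt_pow 2 σ).const_add (1 : ℝ)
  have := ((hasDerivAt_id σ).mul (hd.sqrt (by positivity))).add (Real.hasDerivAt_arsinh σ)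
  refine this.congr_deriv ?_
  simp only [id]
  field_simp
  rw [h1]; ring

theorem integral_sqrt_eq_parabolaArc {n q : ℝ} (hn : 0 < n) (hq : 0 < q) (a b : ℝ) :
    ∫ t in a..b, √(n ^ 2 + (2 * q * t) ^ 2) =
      n ^ 2 / (4 * q) * (parabolaArc (2 * q * b / n) - parabolaArc (2 * q * a / n)) := by
  have hd : ∀ t, HasDerivAt (fun t => n ^ 2 / (4 * q) * parabolaArc (2 * q * t / n))
      (√(n ^ 2 + (2 * q * t) ^ 2)) t := by
    intro t
    have hl : HasDerivAt (fun t => 2 * q * t / n) (2 * q / n) t := by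
      simpa using ((hasDerivAt_id t).const_mul (2 * q)).div_const n
    refine (((hasDerivAt_parabolaArc _).comp t hl).const_mul (n ^ 2 / (4 * q))).congr_deriv ?_
    have : n ^ 2 + (2 * q * t) ^ 2 = n ^ 2 * (1 + (2 * q * t / n) ^ 2) := by field_simp
    rw [this, Real.sqrt_mul (by positivity), Real.sqrt_sq hn.le]
    field_simp
    ring
  rw [intervalIntegral.integral_eq_sub_of_hasDerivAt (fun t _ => hd t)
    ((by fun_prop : Continuous fun t => √(n ^ 2 + (2 * q * t) ^ 2)).intervalIntegrable _ _)]
  ring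

theorem log_2996_lt : Real.log 2996 < 8.0052 := by
  rw [Real.log_lt_iff_lt_exp (by norm_num), show (8.0052 : ℝ) = 8 + 0.0052 by norm_num,
    Real.exp_add, show Real.exp 8 = Real.exp 1 ^ 8 by rw [← Real.exp_nat_mul]; norm_num]
  have h1 : (2.7182818283 : ℝ) ^ 8 ≤ Real.exp 1 ^ 8 :=
    pow_le_pow_left₀ (by norm_num) Real.exp_one_gt_d9.le 8
  have h2 : (1.0052 : ℝ) ≤ Real.exp 0.0052 := by
    have := Real.add_one_le_exp (0.0052 : ℝ)
    linarith
  calc (2996 : ℝ) < 2.7182818283 ^ 8 * 1.0052 := by norm_num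
    _ ≤ Real.exp 1 ^ 8 * Real.exp 0.0052 := by gcongr

/-- The quotient `4 * parabolaArc σ / (σ ^ 2 + 4)` is the length of an extremal arc of shape `σ`.
With `z = exp (arsinh σ)` everything but one logarithm is rational in `z ^ 2`, and the maximum is
near `z ^ 2 = 2996`, where the logarithm is replaced by its tangent. -/
theorem parabolaArc_lt (σ : ℝ) (hσ : 0 ≤ σ) :
    parabolaArc σ < 4.002671 / 4 * (σ ^ 2 + 4) := by
  have h1 : √(1 + σ ^ 2) ^ 2 = 1 + σ ^ 2 := Real.sq_sqrt (by positivity)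
  set r := √(1 + σ ^ 2) with hr
  have hr0 : 0 < r := Real.sqrt_pos.2 (by positivity)
  set z := σ + r with hz
  have hz0 : 0 < z := by positivity
  have hinv : z⁻¹ = r - σ := by
    refine inv_eq_of_mul_eq_one_right ?_
    rw [hz]; linear_combination h1
  have hlog : Real.log (z ^ 2) ≤ Real.log 2996 + (z ^ 2 / 2996 - 1) := by
    have := Real.log_le_sub_one_of_pos (show 0 < z ^ 2 / 2996 by positivity)
    rw [Real.log_div (by positivity) (by norm_num)] at this
    linarith
  rw [Real.log_pow] at hlog
  push_cast at hlog
  have hars : Real.arsinh σ = Real.log z := rfl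
  rw [parabolaArc, hars, ← hr]
  have hl := log_2996_lt
  -- the remaining inequality in `w = z ^ 2` and `w⁻¹ = y ^ 2`
  set y := r - σ with hy
  have hyz : z * y = 1 := by rw [← hinv]; exact mul_inv_cancel₀ hz0.ne'
  have e1 : σ * r = (z ^ 2 - y ^ 2) / 4 := by rw [hz, hy]; ring
  have e2 : σ ^ 2 = (z ^ 2 + y ^ 2 - 2) / 4 := by rw [hz, hy]; linarith [h1]
  rw [e1, e2]
  -- AM–GM with `z * y = 1`. The coefficients are just below `4.002671 / 16 - 1 / 4 - 1 / 5992` and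
  -- `4.002671 / 16 + 1 / 4`, those left in the goal; the constant there is about 2.63e-4.
  have hp : 2 * 3.08e-4 / 2 ≤ 4.8e-8 * z ^ 2 + 0.5 * y ^ 2 := by
    nlinarith [sq_nonneg (z * 2.1e-4 - 0.7 * y)]
  nlinarith

/-- The sharp numerical bound for parabolic arcs in the unit disc. -/
theorem two_mul_integral_sqrt_lt {n q Y : ℝ} (hn : 0 < n) (hq : 0 < q) (hY : 0 ≤ Y)
    (h : n ^ 2 + q ^ 2 * Y ^ 2 ≤ 2 * q) :
    2 * ∫ t in (0 : ℝ)..Y, √(n ^ 2 + (2 * q * t) ^ 2) < 4.002671 := by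
  rw [integral_sqrt_eq_parabolaArc hn hq]
  have h0 : parabolaArc (2 * q * 0 / n) = 0 := by simp [parabolaArc]
  rw [h0, sub_zero]
  set σ := 2 * q * Y / n with hσ
  have hb := parabolaArc_lt σ (by positivity)
  -- For `Y > 0`, `h` says that the end `(n * Y, q * Y ^ 2)` lies in the unit disc centred at `(0,
  -- 1)`, whose boundary passes through the vertex.
  have hs : n ^ 2 * (σ ^ 2 + 4) ≤ 8 * q := by
    have : n ^ 2 * (σ ^ 2 + 4) = 4 * (n ^ 2 + q ^ 2 * Y ^ 2) := by
      rw [hσ]; field_simp; ring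
    linarith
  have hnq : 0 < n ^ 2 / (4 * q) := by positivity
  calc 2 * (n ^ 2 / (4 * q) * parabolaArc σ)
      < 2 * (n ^ 2 / (4 * q) * (4.002671 / 4 * (σ ^ 2 + 4))) := by gcongr
    _ = 4.002671 / (8 * q) * (n ^ 2 * (σ ^ 2 + 4)) := by field_simp; ring
    _ ≤ 4.002671 / (8 * q) * (8 * q) := by gcongr
    _ = 4.002671 := by field_simp

/-- Arithmetic against quadratic mean: this replaces two speeds by the speed of a symmetrized curve.
-/
theorem sqrt_add_sqrt_le {a b c : ℝ} (hc : 0 ≤ c) (h : a ^ 2 + b ^ 2 ≤ 2 * c) : a + b ≤ 2 * √c := by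
  have h1 : √c ^ 2 = c := Real.sq_sqrt hc
  nlinarith [sq_nonneg (a - b), Real.sqrt_nonneg c, abs_le_of_sq_le_sq' (a := a + b) (b := 2 * √c)
    (by nlinarith [sq_nonneg (a - b)]) (by positivity)]

/-- An arc inside the unit disc with both endpoints on the unit circle, which is mapped to itself by
an oblique reflection exchanging the endpoints and is contained in the parabolic segment with the
same endpoints and the same vertex. -/
theorem length_symmetric_arc_lt {E : Type*} [NormedAddCommGroup E]
    [InnerProductSpace ℝ E] [CompleteSpace E] [MeasurableSpace E] [BorelSpace E]
    {T D V : E} {η η' η'' : ℝ → ℝ} (hη : ∀ s, HasDerivAt η (η' s) s)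
    (hη' : ∀ s, HasDerivAt η' (η'' s) s) (hc : Continuous η'') (hη'' : ∀ s, 0 ≤ η'' s)
    (h0 : η 0 = 0) (h1 : η 1 = 1) (hodd : ∀ s, η' (-s) = -η' s)
    (hle : ∀ s ∈ Set.Icc (0 : ℝ) 1, s ^ 2 ≤ η s) (hD : D ≠ 0) (hT : ‖T‖ ≤ 1)
    (hA : ‖T + V + D‖ = 1) (hB : ‖T + V - D‖ = 1) :
    μH[1] ((fun s : ℝ => T + s • D + η s • V) '' Set.Icc (-1) 1) < ENNReal.ofReal 4.002671 := by
  have hcη' : Continuous η' := continuous_iff_continuousAt.2 fun t => (hη' t).continuousAt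
  have hcγ : Continuous fun s => D + η' s • V := by fun_prop
  have hγ : ∀ s, HasDerivAt (fun s : ℝ => T + s • D + η s • V) (D + η' s • V) s := by
    intro s
    have e1 : HasDerivAt (fun s : ℝ => s • D) D s := by
      simpa using (hasDerivAt_id s).smul_const D
    exact (e1.const_add T).add ((hη s).smul_const V)
  refine (hausdorffMeasure_image_Icc_le_integral (by norm_num) (fun s _ => hγ s)
    hcγ.continuousOn).trans_lt ?_
  rw [ENNReal.ofReal_lt_ofReal_iff (by norm_num)]
  have hDp : 0 < ‖D‖ := norm_pos_iff.2 hD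
  have hii : ∀ a b : ℝ, IntervalIntegrable (fun s => ‖D + η' s • V‖) volume a b :=
    fun a b => hcγ.norm.intervalIntegrable a b
  have hsplit : ∫ s in (-1 : ℝ)..1, ‖D + η' s • V‖ =
      ∫ s in (0 : ℝ)..1, (‖D + η' s • V‖ + ‖D - η' s • V‖) := by
    have hneg : ∫ s in (-1 : ℝ)..0, ‖D + η' s • V‖ = ∫ s in (0 : ℝ)..1, ‖D - η' s • V‖ := by
      have := intervalIntegral.integral_comp_neg (a := 0) (b := 1)
        (fun s : ℝ => ‖D + η' s • V‖)
      simp only [hodd, neg_smul, ← sub_eq_add_neg, neg_zero] at this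
      exact this.symm
    rw [← intervalIntegral.integral_add_adjacent_intervals (hii (-1) 0) (hii 0 1), hneg,
      intervalIntegral.integral_add (hii 0 1) ((by fun_prop : Continuous
        fun s => ‖D - η' s • V‖).intervalIntegrable _ _), add_comm]
  -- By the parallelogram law the right side is twice the speed the curve would have if `V` were
  -- orthogonal to `D`.
  have hpair : ∀ s, ‖D + η' s • V‖ + ‖D - η' s • V‖ ≤ 2 * √(‖D‖ ^ 2 + (‖V‖ * η' s) ^ 2) := by
    intro s
    refine sqrt_add_sqrt_le (by positivity) (le_of_eq ?_)
    have := parallelogram_law_with_norm ℝ D (η' s • V)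
    rw [norm_smul, Real.norm_eq_abs] at this
    have h2 := sq_abs (η' s)
    rw [this, mul_pow, h2]
    ring
  have hcmp := integral_sqrt_le_of_convex (n := ‖D‖) (a := 0) (b := 1)
    (X := fun s => ‖V‖ * η s) (X' := fun s => ‖V‖ * η' s) (X'' := fun s => ‖V‖ * η'' s)
    (Y := fun s => ‖V‖ * s ^ 2) (Y' := fun s => ‖V‖ * (2 * s)) hDp zero_le_one
    (fun s => (hη s).const_mul _) (fun s => (hη' s).const_mul _) (by fun_prop)
    (fun s => mul_nonneg (norm_nonneg _) (hη'' s))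
    (fun s => by simpa using (hasDerivAt_pow 2 s).const_mul ‖V‖) (by fun_prop)
    (fun s hs => mul_le_mul_of_nonneg_left (hle s hs) (norm_nonneg _)) (by simp [h0])
    (by simp [h1])
  set M := T + V with hM
  have hpy : ‖M‖ ^ 2 + ‖D‖ ^ 2 = 1 := by
    have := parallelogram_law_with_norm ℝ M D
    rw [hA, hB] at this
    linarith
  have hV : ‖V‖ ≤ 1 + ‖M‖ := by
    have : V = M - T := by rw [hM]; abel
    rw [this]
    linarith [norm_sub_le M T]
  -- By `hpy`, `‖D‖ ^ 2 + (1 + ‖M‖) ^ 2 = 2 * (1 + ‖M‖)`: the largest height `hV` allows is exactly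
  -- the extremal one.
  have hnum := two_mul_integral_sqrt_lt (n := ‖D‖) (q := 1 + ‖M‖) (Y := 1) hDp (by positivity)
    zero_le_one (by nlinarith)
  have hmono : ∫ s in (0 : ℝ)..1, √(‖D‖ ^ 2 + (‖V‖ * (2 * s)) ^ 2) ≤
      ∫ s in (0 : ℝ)..1, √(‖D‖ ^ 2 + (2 * (1 + ‖M‖) * s) ^ 2) := by
    refine intervalIntegral.integral_mono_on zero_le_one (Continuous.intervalIntegrable
      (by fun_prop) _ _) (Continuous.intervalIntegrable (by fun_prop) _ _) fun s hs => ?_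
    have : ‖V‖ * (2 * s) ≤ 2 * (1 + ‖M‖) * s := by nlinarith [hs.1]
    have h3 : 0 ≤ ‖V‖ * (2 * s) := mul_nonneg (norm_nonneg _) (by linarith [hs.1])
    gcongr
  have hfirst : ∫ s in (0 : ℝ)..1, (‖D + η' s • V‖ + ‖D - η' s • V‖) ≤
      ∫ s in (0 : ℝ)..1, 2 * √(‖D‖ ^ 2 + (‖V‖ * η' s) ^ 2) :=
    intervalIntegral.integral_mono_on zero_le_one (Continuous.intervalIntegrable
      (by fun_prop) _ _) (Continuous.intervalIntegrable (by fun_prop) _ _) fun s _ => hpair s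
  rw [intervalIntegral.integral_const_mul] at hfirst
  rw [hsplit]
  linarith

/-! ### Parabolas meeting the circle in four points -/

/-- The function `x ↦ parabolaArc √x` vanishes at 0 and has the decreasing derivative `√(1 + 1 /
x)`, so it is subadditive. -/
theorem parabolaArc_sqrt_add_sub_le {x y : ℝ} (hx : 0 ≤ x) (hy : 0 ≤ y) :
    parabolaArc √(x + y) - parabolaArc √x ≤ parabolaArc √y := by
  have hcp : Continuous parabolaArc :=
    continuous_iff_continuousAt.2 fun t => (hasDerivAt_parabolaArc t).continuousAt
  have hd : ∀ c, 0 ≤ c → ∀ x, 0 < x → HasDerivAt (fun x => parabolaArc √(x + c))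
      (√(1 + (x + c)) / √(x + c)) x := by
    intro c hc x hx
    have h1 : HasDerivAt (fun x => √(x + c)) (1 / (2 * √(x + c))) x :=
      ((hasDerivAt_id x).add_const c).sqrt (by simp only [id]; positivity)
    refine ((hasDerivAt_parabolaArc _).comp x h1).congr_deriv ?_
    rw [Real.sq_sqrt (by positivity)]
    have : 0 < √(x + c) := Real.sqrt_pos.2 (by positivity)
    field_simp
  have hanti : AntitoneOn (fun x => parabolaArc √(x + y) - parabolaArc √(x + 0)) (Set.Ici 0) := by
    refine antitoneOn_of_deriv_nonpos (convex_Ici 0) (by fun_prop) ?_ ?_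
    · intro x hx
      rw [interior_Ici] at hx
      exact ((hd y hy x hx).sub (hd 0 le_rfl x hx)).differentiableAt.differentiableWithinAt
    · intro x hx
      rw [interior_Ici] at hx
      have hx' : 0 < x := hx
      have hsub := (hd y hy x hx).fun_sub (hd 0 le_rfl x hx)
      rw [hsub.deriv, sub_nonpos, ← Real.sqrt_div (by positivity),
        ← Real.sqrt_div (by positivity)]
      refine Real.sqrt_le_sqrt ?_
      rw [add_zero, div_le_div_iff₀ (by positivity) hx']
      nlinarith
  have := hanti (Set.mem_Ici.2 le_rfl) (Set.mem_Ici.2 hx) hx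
  simpa [parabolaArc] using this

/-- Symmetric position of a parabola and the unit circle. -/
theorem two_mul_integral_sqrt_lt_of_symmetric {n q P Q : ℝ} (hn : 0 < n) (hq : 0 < q)
    (hP : 0 ≤ P) (hPQ : P ≤ Q)
    (h : (n ^ 2 + q ^ 2 * (Q + P) ^ 2) * (n ^ 2 + q ^ 2 * (Q - P) ^ 2) ≤ 4 * q ^ 2) :
    2 * ∫ t in P..Q, √(n ^ 2 + (2 * q * t) ^ 2) < 4.002671 := by
  have hQ : 0 ≤ Q := hP.trans hPQ
  -- The circle through the four points over `±P`, `±Q` has its centre at height `(n ^ 2 + q ^ 2 *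
  -- (P ^ 2 + Q ^ 2)) / (2 * q)` above the vertex; `h` says that its radius is at most 1. If the
  -- height is at most 1, the arcs over `[0, P]` can be added for free. Otherwise subadditivity
  -- replaces `[P, Q]` by `[0, √(Q ^ 2 - P ^ 2)]`.
  rcases le_or_gt (n ^ 2 + q ^ 2 * (P ^ 2 + Q ^ 2)) (2 * q) with hle | hgt
  · have hn2 := two_mul_integral_sqrt_lt hn hq hQ (by nlinarith [sq_nonneg (q * P)])
    have hii : ∀ a b : ℝ, IntervalIntegrable (fun t => √(n ^ 2 + (2 * q * t) ^ 2)) volume a b :=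
      fun a b => Continuous.intervalIntegrable (by fun_prop) a b
    have hadd := intervalIntegral.integral_add_adjacent_intervals (hii 0 P) (hii P Q)
    have hpos : 0 ≤ ∫ t in (0 : ℝ)..P, √(n ^ 2 + (2 * q * t) ^ 2) :=
      intervalIntegral.integral_nonneg hP fun t _ => Real.sqrt_nonneg _
    linarith
  · have hd : 0 ≤ Q ^ 2 - P ^ 2 := by nlinarith
    have hbound : n ^ 2 + q ^ 2 * (Q ^ 2 - P ^ 2) ≤ 2 * q := by
      have hn4 : n ^ 2 ≤ 2 * q := by
        refine abs_le_of_sq_le_sq' ?_ (by positivity) |>.2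
        have : n ^ 2 * n ^ 2 ≤ (n ^ 2 + q ^ 2 * (Q + P) ^ 2) * (n ^ 2 + q ^ 2 * (Q - P) ^ 2) := by
          gcongr <;> nlinarith [sq_nonneg (q * (Q + P)), sq_nonneg (q * (Q - P))]
        nlinarith
      -- The product in `h` equals `n ^ 4 + 2 * n ^ 2 * q ^ 2 * (P ^ 2 + Q ^ 2) + q ^ 4 * (Q ^ 2 - P
      -- ^ 2) ^ 2`; `hgt` bounds its middle term from below and leaves `(2 * q - n ^ 2) ^ 2`.
      have : q ^ 2 * (Q ^ 2 - P ^ 2) ≤ 2 * q - n ^ 2 := by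
        refine abs_le_of_sq_le_sq' ?_ (by linarith) |>.2
        have hmul : 0 ≤ (n ^ 2 + q ^ 2 * (P ^ 2 + Q ^ 2) - 2 * q) * n ^ 2 :=
          mul_nonneg (by linarith) (by positivity)
        linarith
      linarith
    have hn2 := two_mul_integral_sqrt_lt hn hq (Real.sqrt_nonneg (Q ^ 2 - P ^ 2))
      (by rwa [Real.sq_sqrt hd])
    refine lt_of_le_of_lt ?_ hn2
    rw [integral_sqrt_eq_parabolaArc hn hq, integral_sqrt_eq_parabolaArc hn hq]
    have hs : ∀ t : ℝ, 0 ≤ t → 2 * q * t / n = √((2 * q / n) ^ 2 * t ^ 2) := by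
      intro t ht
      rw [← mul_pow, Real.sqrt_sq (by positivity)]
      ring
    have hz : parabolaArc (2 * q * 0 / n) = 0 := by simp [parabolaArc]
    have := parabolaArc_sqrt_add_sub_le (x := (2 * q / n) ^ 2 * P ^ 2)
      (y := (2 * q / n) ^ 2 * (Q ^ 2 - P ^ 2)) (by positivity) (by positivity)
    rw [← mul_add, add_sub_cancel, ← hs P hP, ← hs Q hQ] at this
    rw [hz, sub_zero, hs _ (Real.sqrt_nonneg _), Real.sq_sqrt hd]
    gcongr

theorem mul_mul_add_le_of_lt {m s d ε : ℝ} (hm : 0 < m) (hε : 0 ≤ ε) (hd : 0 < d) (hsd : d ≤ s)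
    (hεd : ε ≤ d) (h : s * d < m * (m + ε)) :
    d * m * (s + d / 3 + (m + ε)) ≤ (m + s) * (m + d) * (m + ε) := by
  have hmd : d / 3 ≤ m := by
    by_contra! hcon
    have h1 : m * (m + ε) ≤ d / 3 * (d / 3 + d) := by gcongr
    have h2 : d * d ≤ s * d := by gcongr
    nlinarith
  have hs : 0 < s := by linarith
  have k1 : d / 3 * d ≤ m * s := by gcongr
  have k2 : 0 ≤ m * (m * s - d / 3 * d) := mul_nonneg hm.le (by linarith)
  have k3 : 0 ≤ ε * (m * m + s * m + s * d) := by positivity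
  have k4 : 0 ≤ m * m * m := by positivity
  linear_combination k2 + k3 + k4

/-- Cauchy–Schwarz: the left side of `h` is `Q - P` times the integral of the squared speed. It is
applied pointwise, as `r ≤ r ^ 2 * (Q - P) / 4 + 1 / (Q - P)`. -/
theorem two_mul_integral_sqrt_le_four {N q P Q : ℝ} (hlt : P < Q)
    (h : (Q - P) ^ 2 * (q ^ 2 * ((Q + P) ^ 2 + (Q - P) ^ 2 / 3) + N ^ 2) ≤ 4) :
    2 * ∫ t in P..Q, √(N ^ 2 + (2 * q * t) ^ 2) ≤ 4 := by
  have hD : 0 < Q - P := by linarith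
  have hPQ := hlt.le
  have hw : ∫ t in P..Q, √(N ^ 2 + (2 * q * t) ^ 2) ≤
      ∫ t in P..Q, ((N ^ 2 + (2 * q * t) ^ 2) * ((Q - P) / 4) + 1 / (Q - P)) := by
    refine intervalIntegral.integral_mono_on hPQ (Continuous.intervalIntegrable (by fun_prop) _ _)
      (Continuous.intervalIntegrable (by fun_prop) _ _) fun t _ => ?_
    have h1 : √(N ^ 2 + (2 * q * t) ^ 2) ^ 2 = N ^ 2 + (2 * q * t) ^ 2 :=
      Real.sq_sqrt (by positivity)
    generalize √(N ^ 2 + (2 * q * t) ^ 2) = r at h1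
    rw [← h1, ← sub_nonneg]
    have : r ^ 2 * ((Q - P) / 4) + 1 / (Q - P) - r = (r * (Q - P) / 2 - 1) ^ 2 / (Q - P) := by
      field_simp
      ring
    rw [this]
    positivity
  have hval : ∫ t in P..Q, ((N ^ 2 + (2 * q * t) ^ 2) * ((Q - P) / 4) + 1 / (Q - P)) =
      (Q - P) ^ 2 / 4 * (q ^ 2 * ((Q + P) ^ 2 + (Q - P) ^ 2 / 3) + N ^ 2) + 1 := by
    have hd : ∀ t : ℝ, HasDerivAt (fun t => (N ^ 2 * t + 4 * q ^ 2 / 3 * t ^ 3) * ((Q - P) / 4) +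
        1 / (Q - P) * t) ((N ^ 2 + (2 * q * t) ^ 2) * ((Q - P) / 4) + 1 / (Q - P)) t := by
      intro t
      refine (((((hasDerivAt_id t).const_mul (N ^ 2)).add
        ((hasDerivAt_pow 3 t).const_mul (4 * q ^ 2 / 3))).mul_const ((Q - P) / 4)).add
        ((hasDerivAt_id t).const_mul (1 / (Q - P)))).congr_deriv ?_
      norm_num
      left
      ring
    rw [intervalIntegral.integral_eq_sub_of_hasDerivAt (fun t _ => hd t)
      (Continuous.intervalIntegrable (by fun_prop) _ _)]
    field_simp
    ring
  linarith

/-- A parabola meeting the unit circle in four points (with multiplicity): its two arcs in the disc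
lie over the first and the third of the intervals between consecutive points. -/
theorem integral_sqrt_add_integral_sqrt_lt {n q h k y₁ y₂ y₃ y₄ : ℝ} (hn : 0 < n) (hq : 0 < q)
    (h12 : y₁ ≤ y₂) (h23 : y₂ < y₃) (h34 : y₃ ≤ y₄)
    (hid : ∀ y, (q * y ^ 2 - h) ^ 2 + (n * y - k) ^ 2 - 1 =
      q ^ 2 * ((y - y₁) * (y - y₂) * (y - y₃) * (y - y₄))) :
    (∫ t in y₁..y₂, √(n ^ 2 + (2 * q * t) ^ 2)) + ∫ t in y₃..y₄, √(n ^ 2 + (2 * q * t) ^ 2)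
      < 4.002671 := by
  have i0 := hid 0
  have i1 := hid 1
  have i2 := hid (-1)
  have i3 := hid 2
  have i4 := hid (-2)
  have hsum : y₁ + y₂ + y₃ + y₄ = 0 := by
    have : q ^ 2 * (y₁ + y₂ + y₃ + y₄) = 0 := by
      linear_combination (1 / 12) * i3 - (1 / 12) * i4 - (1 / 6) * i1 + (1 / 6) * i2
    exact (mul_eq_zero.1 this).resolve_left (by positivity)
  -- As the abscissas sum to 0, they are `±Q + e` and `±P - e`; `e` measures the asymmetry.
  obtain ⟨e, he⟩ : ∃ e, e = (y₄ + y₁) / 2 := ⟨_, rfl⟩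
  obtain ⟨Q, hQ⟩ : ∃ Q, Q = (y₄ - y₁) / 2 := ⟨_, rfl⟩
  obtain ⟨P, hP⟩ : ∃ P, P = (y₃ - y₂) / 2 := ⟨_, rfl⟩
  obtain rfl : y₁ = e - Q := by linarith
  obtain rfl : y₂ = -(P + e) := by linarith
  obtain rfl : y₃ = P - e := by linarith
  obtain rfl : y₄ = Q + e := by linarith
  clear he hQ hP hsum
  have hP0 : 0 < P := by linarith
  have he1 : |2 * e| ≤ Q - P := abs_le.2 ⟨by linarith, by linarith⟩
  have hPQ : P ≤ Q := by linarith [abs_nonneg (2 * e)]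
  -- the radius of the circle
  have hrad : (n ^ 2 + q ^ 2 * (Q + P) ^ 2) * (n ^ 2 + q ^ 2 * (Q - P) ^ 2) *
      (n ^ 2 + q ^ 2 * (2 * e) ^ 2) = 4 * q ^ 2 * n ^ 2 := by
    have c2 : 2 * q * h = n ^ 2 - q ^ 2 * (-(Q ^ 2 + P ^ 2 + 2 * e ^ 2)) := by
      linear_combination (-1 / 2) * i1 - (1 / 2) * i2 + i0
    have c3 : 2 * n * k = q ^ 2 * (2 * e * (Q ^ 2 - P ^ 2)) := by
      linear_combination (-1 / 2) * i1 + (1 / 2) * i2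
    have c4 : h ^ 2 + k ^ 2 - 1 = q ^ 2 * ((e ^ 2 - Q ^ 2) * (e ^ 2 - P ^ 2)) := by
      linear_combination i0
    linear_combination (-n ^ 2) * (2 * q * h + (n ^ 2 - q ^ 2 * (-(Q ^ 2 + P ^ 2 + 2 * e ^ 2)))) * c2
      - q ^ 2 * (2 * n * k + q ^ 2 * (2 * e * (Q ^ 2 - P ^ 2))) * c3 + 4 * q ^ 2 * n ^ 2 * c4
  set N := √(n ^ 2 + q ^ 2 * (2 * e) ^ 2) with hN
  have hN2 : N ^ 2 = n ^ 2 + q ^ 2 * (2 * e) ^ 2 := Real.sq_sqrt (by positivity)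
  have hN0 : 0 < N := Real.sqrt_pos.2 (by positivity)
  set g : ℝ → ℝ := fun t => √(n ^ 2 + (2 * q * t) ^ 2) with hg
  have hgc : Continuous g := by fun_prop
  have hii : ∀ a b : ℝ, IntervalIntegrable g volume a b := fun a b => hgc.intervalIntegrable a b
  have hneg : ∫ t in (e - Q)..(-(P + e)), g t = ∫ t in (P + e)..(Q - e), g t := by
    have := intervalIntegral.integral_comp_neg (a := P + e) (b := Q - e) g
    rw [neg_sub] at this
    rw [← this]
    simp [hg]
  -- Exchanging the upper limits makes both intervals translates of `[P, Q]`. The quadratic mean of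
  -- the speeds at `t ± e` is then the speed of a symmetric parabola with `N` in place of `n`.
  have hshift : (∫ t in (P + e)..(Q - e), g t) + ∫ t in (P - e)..(Q + e), g t =
      ∫ t in P..Q, (g (t + e) + g (t - e)) := by
    rw [intervalIntegral.integral_add (Continuous.intervalIntegrable (by fun_prop) _ _)
      (Continuous.intervalIntegrable (by fun_prop) _ _),
      intervalIntegral.integral_comp_add_right, intervalIntegral.integral_comp_sub_right]
    have a1 := intervalIntegral.integral_add_adjacent_intervals (hii (P + e) (Q - e))
      (hii (Q - e) (Q + e))
    have a2 := intervalIntegral.integral_add_adjacent_intervals (hii (P - e) (Q - e))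
      (hii (Q - e) (Q + e))
    linarith
  have hmid : ∫ t in P..Q, (g (t + e) + g (t - e)) ≤
      2 * ∫ t in P..Q, √(N ^ 2 + (2 * q * t) ^ 2) := by
    rw [← intervalIntegral.integral_const_mul]
    refine intervalIntegral.integral_mono_on hPQ (Continuous.intervalIntegrable (by fun_prop) _ _)
      (Continuous.intervalIntegrable (by fun_prop) _ _) fun t _ => ?_
    refine sqrt_add_sqrt_le (by positivity) ?_
    rw [Real.sq_sqrt (by positivity), Real.sq_sqrt (by positivity), hN2]
    apply le_of_eq
    ring
  rw [hneg, hshift]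
  refine hmid.trans_lt ?_
  have hS2 : (Q - P) ^ 2 ≤ (Q + P) ^ 2 := by nlinarith
  have hE2 : (2 * e) ^ 2 ≤ (Q - P) ^ 2 := sq_le_sq.2 (he1.trans (le_abs_self _))
  generalize (2 * e) = E at *
  rw [hN2.symm] at hrad
  -- Passing from `n` to `N` keeps the radius at most 1 exactly when `(N ^ 2 - n ^ 2) * (q ^ 4 * (Q
  -- + P) ^ 2 * (Q - P) ^ 2 - n ^ 2 * N ^ 2) ≥ 0`. In the other case the arcs are short enough for
  -- the bound 4.
  rcases le_or_gt (n ^ 2 * N ^ 2) (q ^ 4 * ((Q + P) ^ 2 * (Q - P) ^ 2)) with hle | hgt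
  · refine two_mul_integral_sqrt_lt_of_symmetric hN0 hq hP0.le hPQ ?_
    have hmul : 0 ≤ q ^ 2 * E ^ 2 * (q ^ 4 * ((Q + P) ^ 2 * (Q - P) ^ 2) - n ^ 2 * N ^ 2) :=
      mul_nonneg (by positivity) (by linarith)
    refine le_of_mul_le_mul_left (a := n ^ 2) ?_ (by positivity)
    rw [hN2] at hmul hrad ⊢
    linarith
  rcases hPQ.eq_or_lt with rfl | hlt
  · norm_num
  have hD : 0 < Q - P := by linarith
  have hcrude : (Q - P) ^ 2 * (q ^ 2 * ((Q + P) ^ 2 + (Q - P) ^ 2 / 3) + N ^ 2) ≤ 4 := by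
    refine le_of_mul_le_mul_left (a := q ^ 2 * n ^ 2) ?_ (by positivity)
    rw [show q ^ 2 * n ^ 2 * 4 = 4 * q ^ 2 * n ^ 2 by ring, ← hrad]
    rw [hN2] at hgt ⊢
    have key := mul_mul_add_le_of_lt (m := n ^ 2) (s := q ^ 2 * (Q + P) ^ 2)
      (d := q ^ 2 * (Q - P) ^ 2) (ε := q ^ 2 * E ^ 2) (by positivity) (by positivity)
      (by positivity) (by gcongr) (by gcongr) (by linear_combination hgt)
    linear_combination key
  linarith [two_mul_integral_sqrt_le_four hlt hcrude]

/-! ### The sublevel set of a quartic -/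

/-- The sublevel set is compact and its extreme points are roots. If `R` is positive somewhere
between them, dividing out these two roots leaves a quadratic negative there, hence with two
distinct real roots; these lie between the extreme ones. -/
theorem quartic_nonpos_cases {A B C D E : ℝ} (hA : 0 < A) {R : ℝ → ℝ}
    (hR : ∀ t, R t = A * t ^ 4 + B * t ^ 3 + C * t ^ 2 + D * t + E) :
    (∀ t, 0 < R t) ∨
    (∃ t₁ t₂, t₁ ≤ t₂ ∧ R t₁ = 0 ∧ R t₂ = 0 ∧ ∀ t, R t ≤ 0 ↔ t ∈ Set.Icc t₁ t₂) ∨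
    ∃ t₁ t₂ t₃ t₄, t₁ ≤ t₂ ∧ t₂ < t₃ ∧ t₃ ≤ t₄ ∧
      ∀ t, R t = A * ((t - t₁) * (t - t₂) * (t - t₃) * (t - t₄)) := by
  have hcont : Continuous R := by rw [funext hR]; fun_prop
  set K : Set ℝ := {t | R t ≤ 0} with hK
  rcases Set.eq_empty_or_nonempty K with he | hne
  · left
    intro t
    by_contra! h
    exact Set.notMem_empty t (he ▸ (show t ∈ K from h))
  right
  have hclosed : IsClosed K := isClosed_le hcont continuous_const
  have hbdd : K ⊆ Metric.closedBall 0 (1 + (|B| + |C| + |D| + |E|) / A) := by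
    intro t ht
    have ht : R t ≤ 0 := ht
    rw [mem_closedBall_zero_iff, Real.norm_eq_abs]
    by_contra! hcon
    have hpos : 0 ≤ (|B| + |C| + |D| + |E|) / A := by positivity
    have h1 : 1 < |t| := by linarith
    have h2 : |B| + |C| + |D| + |E| < A * |t| := by
      have : (|B| + |C| + |D| + |E|) / A < |t| := by linarith
      rw [div_lt_iff₀ hA] at this
      linarith
    have h4 : A * t ^ 4 = A * |t| * |t| ^ 3 := by
      have := (even_two_mul 2).pow_abs t
      norm_num at this
      rw [← this]; ring
    have e3 : -(|B| * |t| ^ 3) ≤ B * t ^ 3 := by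
      rw [← abs_pow, ← abs_mul]; exact neg_abs_le _
    have e2 : -(|C| * |t| ^ 3) ≤ C * t ^ 2 := by
      have : |C * t ^ 2| ≤ |C| * |t| ^ 3 := by
        rw [abs_mul, abs_pow]; gcongr; exacts [h1.le, by norm_num]
      linarith [neg_abs_le (C * t ^ 2)]
    have e1 : -(|D| * |t| ^ 3) ≤ D * t := by
      have : |D * t| ≤ |D| * |t| ^ 3 := by
        rw [abs_mul]; gcongr; exact le_self_pow₀ h1.le (by norm_num)
      linarith [neg_abs_le (D * t)]
    have e0 : -(|E| * |t| ^ 3) ≤ E := by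
      have : |E| ≤ |E| * |t| ^ 3 := le_mul_of_one_le_right (abs_nonneg E) (one_le_pow₀ h1.le)
      linarith [neg_abs_le E]
    have hlt : (|B| + |C| + |D| + |E|) * |t| ^ 3 < A * |t| * |t| ^ 3 := by gcongr
    rw [hR, h4] at ht
    linarith
  have hcomp : IsCompact K := Metric.isCompact_of_isClosed_isBounded hclosed
    (Metric.isBounded_closedBall.subset hbdd)
  obtain ⟨t₁, ht₁, hmin⟩ := hcomp.exists_isLeast hne
  obtain ⟨t₄, ht₄, hmax⟩ := hcomp.exists_isGreatest hne
  have h14 : t₁ ≤ t₄ := hmin ht₄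
  have hR1 : R t₁ = 0 := by
    refine le_antisymm ht₁ (ge_of_tendsto (hcont.continuousAt.tendsto.mono_left
      (nhdsWithin_le_nhds (s := Set.Iio t₁))) ?_)
    filter_upwards [self_mem_nhdsWithin] with t ht
    by_contra! h
    exact absurd (hmin (show t ∈ K from h.le)) (not_le.2 ht)
  have hR4 : R t₄ = 0 := by
    refine le_antisymm ht₄ (ge_of_tendsto (hcont.continuousAt.tendsto.mono_left
      (nhdsWithin_le_nhds (s := Set.Ioi t₄))) ?_)
    filter_upwards [self_mem_nhdsWithin] with t ht
    by_contra! h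
    exact absurd (hmax (show t ∈ K from h.le)) (not_le.2 ht)
  by_cases hall : ∀ t ∈ Set.Icc t₁ t₄, R t ≤ 0
  · exact Or.inl ⟨t₁, t₄, h14, hR1, hR4, fun t => ⟨fun h => ⟨hmin h, hmax h⟩, hall t⟩⟩
  push Not at hall
  obtain ⟨x, hx, hRx⟩ := hall
  have h14' : t₁ < t₄ := by
    refine h14.lt_of_ne ?_
    rintro rfl
    rw [le_antisymm hx.2 hx.1, hR1] at hRx
    exact lt_irrefl _ hRx
  right
  obtain ⟨β, hβ⟩ : ∃ β, β = B + A * (t₁ + t₄) := ⟨_, rfl⟩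
  obtain ⟨γ, hγ⟩ : ∃ γ, γ = C + β * (t₁ + t₄) - A * (t₁ * t₄) := ⟨_, rfl⟩
  obtain ⟨r₁, hr₁⟩ : ∃ r, r = D - β * (t₁ * t₄) + γ * (t₁ + t₄) := ⟨_, rfl⟩
  have hrem : ∀ t, R t = (t - t₁) * (t - t₄) * (A * t ^ 2 + β * t + γ) +
      (r₁ * t + (E - γ * (t₁ * t₄))) := by
    intro t
    rw [hR, hr₁, hγ, hβ]; ring
  have q1 := hrem t₁
  have q4 := hrem t₄
  rw [hR1] at q1
  rw [hR4] at q4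
  have hr0 : r₁ = 0 := by
    have : r₁ * (t₁ - t₄) = 0 := by linear_combination q4 - q1
    exact (mul_eq_zero.1 this).resolve_right (by linarith)
  have hfac : ∀ t, R t = (t - t₁) * (t - t₄) * (A * t ^ 2 + β * t + γ) := by
    intro t
    rw [hr0] at q1
    rw [hrem, hr0]
    linear_combination -q1
  have hx1 : t₁ < x := by
    refine hx.1.lt_of_ne ?_
    rintro rfl
    exact hRx.ne' hR1
  have hx4 : x < t₄ := by
    refine hx.2.lt_of_ne ?_
    rintro rfl
    exact hRx.ne' hR4
  have hneg : A * x ^ 2 + β * x + γ < 0 := by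
    by_contra! h
    have : (x - t₁) * (x - t₄) * (A * x ^ 2 + β * x + γ) ≤ 0 :=
      mul_nonpos_of_nonpos_of_nonneg
        (mul_nonpos_of_nonneg_of_nonpos (by linarith) (by linarith)) h
    rw [← hfac] at this
    linarith
  have hdisc : 0 < β ^ 2 - 4 * A * γ := by
    nlinarith [sq_nonneg (2 * A * x + β)]
  set d := √(β ^ 2 - 4 * A * γ) with hd
  have hd0 : 0 < d := Real.sqrt_pos.2 hdisc
  have hd2 : d ^ 2 = β ^ 2 - 4 * A * γ := Real.sq_sqrt hdisc.le
  obtain ⟨t₂, ht₂⟩ : ∃ t, t = (-β - d) / (2 * A) := ⟨_, rfl⟩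
  obtain ⟨t₃, ht₃⟩ : ∃ t, t = (-β + d) / (2 * A) := ⟨_, rfl⟩
  have h23 : t₂ < t₃ := by
    rw [ht₂, ht₃]
    gcongr
    linarith
  have hq : ∀ t, A * t ^ 2 + β * t + γ = A * ((t - t₂) * (t - t₃)) := by
    intro t
    rw [ht₂, ht₃]
    field_simp
    linear_combination hd2
  have hfac' : ∀ t, R t = A * ((t - t₁) * (t - t₂) * (t - t₃) * (t - t₄)) := by
    intro t
    rw [hfac, hq]; ring
  rw [hq] at hneg
  have hneg' : (x - t₂) * (x - t₃) < 0 := by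
    by_contra! h
    exact absurd hneg (not_lt.2 (by positivity))
  have hx2 : t₂ < x := by
    by_contra! h
    nlinarith
  have hx3 : x < t₃ := by
    by_contra! h
    nlinarith
  refine ⟨t₁, t₂, t₃, t₄, ?_, h23, ?_, hfac'⟩
  · by_contra! h
    have : R ((t₁ + t₂) / 2) ≤ 0 := by
      rw [hfac, hq]
      refine mul_nonpos_of_nonneg_of_nonpos (mul_nonneg_of_nonpos_of_nonpos
        (by linarith) (by linarith)) (mul_nonpos_of_nonneg_of_nonpos hA.le
        (mul_nonpos_of_nonneg_of_nonpos (by linarith) (by linarith)))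
    have := hmin this
    linarith
  · by_contra! h
    have : R ((t₃ + t₄) / 2) ≤ 0 := by
      rw [hfac, hq]
      refine mul_nonpos_of_nonneg_of_nonpos (mul_nonneg
        (by linarith) (by linarith)) (mul_nonpos_of_nonneg_of_nonpos hA.le
        (mul_nonpos_of_nonneg_of_nonpos (by linarith) (by linarith)))
    have := hmax this
    linarith

/-! ### Arcs of hyperbolas -/

section Branches

variable {E : Type*} [NormedAddCommGroup E] [NormedSpace ℝ E]

theorem hausdorffMeasure_image_Icc_self {E : Type*} [NormedAddCommGroup E] [MeasurableSpace E] [BorelSpace E] (γ : ℝ → E) (a : ℝ) :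
    μH[1] (γ '' Set.Icc a a) = 0 := by
  have := hausdorffMeasure_image_Icc_le (γ := γ) (φ := fun _ => 0) (a := a) (b := a) (by
    intro s hs t ht _
    rw [le_antisymm hs.2 hs.1, le_antisymm ht.2 ht.1]
    simp)
  simpa using this

/-- The arcs of the two branches of a hyperbola cut out by the disc are together no longer than the
two diagonals of the quadrilateral formed by their endpoints. -/
theorem length_opposite_branches_le [MeasurableSpace E] [BorelSpace E] {C U W : E}
    {t₁ t₂ t₃ t₄ : ℝ} (h12 : t₁ ≤ t₂) (h2 : t₂ < 0) (h3 : 0 < t₃) (h34 : t₃ ≤ t₄)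
    (hz : ∀ t ∈ ({t₁, t₂, t₃, t₄} : Set ℝ), ‖C + t • U + t⁻¹ • W‖ ≤ 1) :
    μH[1] ((fun t : ℝ => C + t • U + t⁻¹ • W) '' Set.Icc t₁ t₂) +
      μH[1] ((fun t : ℝ => C + t • U + t⁻¹ • W) '' Set.Icc t₃ t₄) ≤ ENNReal.ofReal 4 := by
  have h1 : t₁ < 0 := by linarith
  have h4 : 0 < t₄ := by linarith
  have n1 := h1.ne
  have n2 := h2.ne
  have n3 := h3.ne'
  have n4 := h4.ne'
  set a := -(t₂ * t₃)⁻¹ with ha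
  set b := -(t₁ * t₄)⁻¹ with hb
  have hb0 : 0 < b := by
    rw [hb, ← inv_neg]
    exact inv_pos.2 (by nlinarith)
  by_cases hab : t₁ = t₂ ∧ t₃ = t₄
  · obtain ⟨rfl, rfl⟩ := hab
    rw [hausdorffMeasure_image_Icc_self, hausdorffMeasure_image_Icc_self, add_zero]
    exact zero_le
  have hba : 0 < a - b := by
    have hlt : t₁ * t₄ < t₂ * t₃ := by
      rcases h12.eq_or_lt with rfl | h
      · have : t₃ < t₄ := h34.lt_of_ne fun h => hab ⟨rfl, h⟩
        nlinarith
      · nlinarith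
    have h5 : t₂ * t₃ < 0 := by nlinarith
    rw [ha, hb, sub_pos, neg_lt_neg_iff]
    exact inv_lt_inv_of_neg h5 (hlt.trans h5) |>.2 hlt
  set e₁ := U + a • W with he₁
  set e₂ := U + b • W with he₂
  -- `e₁` and `e₂` are the directions of the chords from `t₂` to `t₃` and from `t₁` to `t₄`. Along
  -- both branches the coordinate along `-e₁` and the one along `e₂` increase, so their weighted sum
  -- controls length; the total increase over the two arcs is the sum of the two chords.
  set φ : ℝ → ℝ := fun t => ((b * t - t⁻¹) / (a - b)) * ‖e₁‖ +
    (t + (b * t - t⁻¹) / (a - b)) * ‖e₂‖ with hφ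
  have key : ∀ s t : ℝ, s ≤ t → s ≠ 0 → t ≠ 0 → t⁻¹ ≤ s⁻¹ →
      dist (C + s • U + s⁻¹ • W) (C + t • U + t⁻¹ • W) ≤ φ t - φ s := by
    intro s t hst hs ht hinv
    obtain ⟨α, hα⟩ : ∃ α, α = (b * (t - s) + (s⁻¹ - t⁻¹)) / (a - b) := ⟨_, rfl⟩
    have hα0 : 0 ≤ α := by
      rw [hα]
      exact div_nonneg (add_nonneg (mul_nonneg hb0.le (by linarith)) (by linarith)) hba.le
    have hα' : α * (a - b) = b * (t - s) + (s⁻¹ - t⁻¹) := by rw [hα]; field_simp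
    have hdiff : (C + t • U + t⁻¹ • W) - (C + s • U + s⁻¹ • W) =
        (-α) • e₁ + (t - s + α) • e₂ := by
      have : t⁻¹ - s⁻¹ = -α * a + (t - s + α) * b := by linarith
      rw [he₁, he₂]
      linear_combination (norm := module) this • W
    rw [dist_comm, dist_eq_norm, hdiff]
    refine (norm_add_le _ _).trans (le_of_eq ?_)
    rw [norm_smul, norm_smul, norm_neg, Real.norm_of_nonneg hα0,
      Real.norm_of_nonneg (show 0 ≤ t - s + α by linarith), hφ, hα]
    field_simp
    ring
  have b1 := hausdorffMeasure_image_Icc_le (γ := fun t : ℝ => C + t • U + t⁻¹ • W) (φ := φ)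
    (a := t₁) (b := t₂) fun s hs t ht hst => key s t hst (by linarith [hs.2]) (by linarith [ht.2])
      ((inv_le_inv_of_neg (by linarith [ht.2]) (by linarith [hs.2])).2 hst)
  have b2 := hausdorffMeasure_image_Icc_le (γ := fun t : ℝ => C + t • U + t⁻¹ • W) (φ := φ)
    (a := t₃) (b := t₄) fun s hs t ht hst => key s t hst (by linarith [hs.1]) (by linarith [ht.1])
      (inv_anti₀ (by linarith [hs.1]) hst)
  refine (add_le_add b1 b2).trans ?_
  have p1 := key t₁ t₂ h12 h1.ne h2.ne ((inv_le_inv_of_neg h2 h1).2 h12)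
  have p2 := key t₃ t₄ h34 h3.ne' h4.ne' (inv_anti₀ h3 h34)
  rw [← ENNReal.ofReal_add (dist_nonneg.trans p1) (dist_nonneg.trans p2)]
  refine ENNReal.ofReal_le_ofReal ?_
  have d1 : (t₃ - t₂) * ‖e₁‖ ≤ 2 := by
    have : (C + t₃ • U + t₃⁻¹ • W) - (C + t₂ • U + t₂⁻¹ • W) = (t₃ - t₂) • e₁ := by
      have : t₃⁻¹ - t₂⁻¹ = (t₃ - t₂) * a := by rw [ha]; field_simp; ring
      rw [he₁]
      linear_combination (norm := module) this • W
    have h := norm_sub_le (C + t₃ • U + t₃⁻¹ • W) (C + t₂ • U + t₂⁻¹ • W)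
    rw [this, norm_smul, Real.norm_of_nonneg (by linarith)] at h
    linarith [hz t₃ (by simp), hz t₂ (by simp)]
  have d2 : (t₄ - t₁) * ‖e₂‖ ≤ 2 := by
    have : (C + t₄ • U + t₄⁻¹ • W) - (C + t₁ • U + t₁⁻¹ • W) = (t₄ - t₁) • e₂ := by
      have : t₄⁻¹ - t₁⁻¹ = (t₄ - t₁) * b := by rw [hb]; field_simp; ring
      rw [he₂]
      linear_combination (norm := module) this • W
    have h := norm_sub_le (C + t₄ • U + t₄⁻¹ • W) (C + t₁ • U + t₁⁻¹ • W)
    rw [this, norm_smul, Real.norm_of_nonneg (by linarith)] at h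
    linarith [hz t₄ (by simp), hz t₁ (by simp)]
  have hsum : φ t₂ - φ t₁ + (φ t₄ - φ t₃) = (t₃ - t₂) * ‖e₁‖ + (t₄ - t₁) * ‖e₂‖ := by
    have hα : b * (t₂ - t₁ + t₄ - t₃) - (t₂⁻¹ - t₁⁻¹ + t₄⁻¹ - t₃⁻¹) = (t₃ - t₂) * (a - b) := by
      rw [ha, hb]; field_simp; ring
    have hα' : (b * (t₂ - t₁ + t₄ - t₃) - (t₂⁻¹ - t₁⁻¹ + t₄⁻¹ - t₃⁻¹)) / (a - b) = t₃ - t₂ := by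
      rw [hα]; field_simp
    simp only [hφ]
    linear_combination (‖e₁‖ + ‖e₂‖) * hα'
  linarith

end Branches

theorem image_hyperbola_neg {E : Type*} [AddCommGroup E] [Module ℝ E] (C U W : E) (a b : ℝ) :
    (fun t : ℝ => C + t • U + t⁻¹ • W) '' Set.Icc a b =
      (fun t : ℝ => C + t • (-U) + t⁻¹ • (-W)) '' Set.Icc (-b) (-a) := by
  rw [← Set.image_neg_Icc, Set.image_image]
  refine Set.image_congr fun t _ => ?_
  rw [inv_neg]
  module

/-! ### Conics meeting the disc in a single arc -/

section SingleArc

variable {E : Type*} [NormedAddCommGroup E] [InnerProductSpace ℝ E] [CompleteSpace E]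
  [MeasurableSpace E] [BorelSpace E]

theorem length_parabola_arc_lt {C U W : E} {t₁ t₂ : ℝ} (h12 : t₁ ≤ t₂)
    (h1 : ‖C + t₁ • U + t₁ ^ 2 • W‖ = 1) (h2 : ‖C + t₂ • U + t₂ ^ 2 • W‖ = 1)
    (hle : ∀ t ∈ Set.Icc t₁ t₂, ‖C + t • U + t ^ 2 • W‖ ≤ 1)
    (hinj : t₁ < t₂ → C + t₁ • U + t₁ ^ 2 • W ≠ C + t₂ • U + t₂ ^ 2 • W) :
    μH[1] ((fun t : ℝ => C + t • U + t ^ 2 • W) '' Set.Icc t₁ t₂) < ENNReal.ofReal 4.002671 := by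
  rcases h12.eq_or_lt with rfl | hlt
  · rw [hausdorffMeasure_image_Icc_self]
    exact ENNReal.ofReal_pos.2 (by norm_num)
  obtain ⟨m, hm⟩ : ∃ m, m = (t₁ + t₂) / 2 := ⟨_, rfl⟩
  obtain ⟨d, hd⟩ : ∃ d, d = (t₂ - t₁) / 2 := ⟨_, rfl⟩
  have hd0 : 0 < d := by rw [hd]; linarith
  obtain rfl : t₁ = m - d := by rw [hm, hd]; ring
  obtain rfl : t₂ = m + d := by linarith
  have hA : C + m • U + m ^ 2 • W + d ^ 2 • W + (d • U + (2 * m * d) • W) =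
      C + (m + d) • U + (m + d) ^ 2 • W := by module
  have hB : C + m • U + m ^ 2 • W + d ^ 2 • W - (d • U + (2 * m * d) • W) =
      C + (m - d) • U + (m - d) ^ 2 • W := by module
  have key := length_symmetric_arc_lt (T := C + m • U + m ^ 2 • W) (V := d ^ 2 • W)
    (D := d • U + (2 * m * d) • W) (η := fun s => s ^ 2) (η' := fun s => 2 * s) (η'' := fun _ => 2)
    (fun s => by simpa using hasDerivAt_pow 2 s)
    (fun s => by simpa using (hasDerivAt_id s).const_mul (2 : ℝ))
    continuous_const (fun _ => by norm_num) (by norm_num) (by norm_num) (fun s => by ring)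
    (fun _ _ => le_rfl) ?_ (hle m ⟨by linarith, by linarith⟩) (hA ▸ h2) (hB ▸ h1)
  · refine (measure_mono ?_).trans_lt key
    rintro _ ⟨t, ht, rfl⟩
    refine ⟨(t - m) / d, ⟨?_, ?_⟩, ?_⟩
    · rw [le_div_iff₀ hd0]; linarith [ht.1]
    · rw [div_le_iff₀ hd0]; linarith [ht.2]
    · obtain ⟨s, rfl⟩ : ∃ s, t = m + d * s := ⟨(t - m) / d, by field_simp; ring⟩
      have : (m + d * s - m) / d = s := by field_simp; ring
      simp only [this]
      module
  · intro h0
    refine hinj hlt ?_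
    rw [← hA, ← hB, h0, add_zero, sub_zero]

/-- About the geometric mean `g` of the end parameters the arc is `cosh` times `g • U + g⁻¹ • W`
plus `sinh` times `g • U - g⁻¹ • W`. Taking `s` proportional to `sinh` puts it in the form of
`length_symmetric_arc_lt`; `c` and `κ` are the values of `cosh` and `sinh` at the end. -/
theorem length_hyperbola_arc_lt_of_pos {C U W : E} {t₁ t₂ : ℝ} (h0 : 0 < t₁) (h12 : t₁ ≤ t₂)
    (h1 : ‖C + t₁ • U + t₁⁻¹ • W‖ = 1) (h2 : ‖C + t₂ • U + t₂⁻¹ • W‖ = 1)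
    (hle : ∀ t ∈ Set.Icc t₁ t₂, ‖C + t • U + t⁻¹ • W‖ ≤ 1)
    (hinj : t₁ < t₂ → C + t₁ • U + t₁⁻¹ • W ≠ C + t₂ • U + t₂⁻¹ • W) :
    μH[1] ((fun t : ℝ => C + t • U + t⁻¹ • W) '' Set.Icc t₁ t₂) < ENNReal.ofReal 4.002671 := by
  rcases h12.eq_or_lt with rfl | hlt
  · rw [hausdorffMeasure_image_Icc_self]
    exact ENNReal.ofReal_pos.2 (by norm_num)
  have h02 : 0 < t₂ := h0.trans hlt
  -- `t₁ = g / θ` and `t₂ = g * θ`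
  obtain ⟨g, θ, hg, hθ, rfl, rfl⟩ : ∃ g θ : ℝ, 0 < g ∧ 1 < θ ∧ t₁ = g / θ ∧ t₂ = g * θ := by
    refine ⟨√(t₁ * t₂), √(t₂ / t₁), Real.sqrt_pos.2 (by positivity), ?_, ?_, ?_⟩
    · rw [Real.lt_sqrt (by norm_num), one_pow, one_lt_div h0]; exact hlt
    · rw [← Real.sqrt_div (by positivity), show t₁ * t₂ / (t₂ / t₁) = t₁ ^ 2 by field_simp,
        Real.sqrt_sq h0.le]
    · rw [← Real.sqrt_mul (by positivity), show t₁ * t₂ * (t₂ / t₁) = t₂ ^ 2 by field_simp,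
        Real.sqrt_sq h02.le]
  have hθ0 : 0 < θ := by linarith
  obtain ⟨c, hc⟩ : ∃ c, c = (θ + θ⁻¹) / 2 := ⟨_, rfl⟩
  obtain ⟨κ, hκ⟩ : ∃ κ, κ = (θ - θ⁻¹) / 2 := ⟨_, rfl⟩
  have hκ0 : 0 < κ := by
    rw [hκ]
    linarith [inv_lt_one_of_one_lt₀ hθ]
  have hcκ : c ^ 2 = 1 + κ ^ 2 := by rw [hc, hκ]; field_simp; ring
  have hc0 : 0 < c := by rw [hc]; positivity
  have hc1 : 1 < c := by nlinarith [pow_pos hκ0 2]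
  have hsq : ∀ s : ℝ, 0 < √(1 + κ ^ 2 * s ^ 2) := fun s => Real.sqrt_pos.2 (by positivity)
  have hsq2 : ∀ s : ℝ, √(1 + κ ^ 2 * s ^ 2) ^ 2 = 1 + κ ^ 2 * s ^ 2 :=
    fun s => Real.sq_sqrt (by positivity)
  have hc1' : c - 1 ≠ 0 := by linarith
  have hdr : ∀ s : ℝ, HasDerivAt (fun s => √(1 + κ ^ 2 * s ^ 2))
      (κ ^ 2 * s / √(1 + κ ^ 2 * s ^ 2)) s := by
    intro s
    have : HasDerivAt (fun s : ℝ => 1 + κ ^ 2 * s ^ 2) (κ ^ 2 * (2 * s)) s := by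
      simpa using ((hasDerivAt_pow 2 s).const_mul (κ ^ 2)).const_add 1
    refine (this.sqrt (by positivity)).congr_deriv ?_
    have := hsq s
    field_simp
  have hA : C + (g • U + g⁻¹ • W) + (c - 1) • (g • U + g⁻¹ • W) + κ • (g • U - g⁻¹ • W) =
      C + (g * θ) • U + (g * θ)⁻¹ • W := by
    have e1 : g * θ = (c + κ) * g := by rw [hc, hκ]; ring
    have e2 : (g * θ)⁻¹ = (c - κ) * g⁻¹ := by rw [hc, hκ]; field_simp; ring
    rw [e2, e1]
    module
  have hB : C + (g • U + g⁻¹ • W) + (c - 1) • (g • U + g⁻¹ • W) - κ • (g • U - g⁻¹ • W) =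
      C + (g / θ) • U + (g / θ)⁻¹ • W := by
    have e1 : g / θ = (c - κ) * g := by rw [hc, hκ]; field_simp; ring
    have e2 : (g / θ)⁻¹ = (c + κ) * g⁻¹ := by rw [hc, hκ]; field_simp; ring
    rw [e2, e1]
    module
  have key := length_symmetric_arc_lt (T := C + (g • U + g⁻¹ • W))
    (V := (c - 1) • (g • U + g⁻¹ • W)) (D := κ • (g • U - g⁻¹ • W))
    (η := fun s => (√(1 + κ ^ 2 * s ^ 2) - 1) / (c - 1))
    (η' := fun s => (κ ^ 2 * s / √(1 + κ ^ 2 * s ^ 2)) / (c - 1))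
    (η'' := fun s => (κ ^ 2 / √(1 + κ ^ 2 * s ^ 2) ^ 3) / (c - 1))
    (fun s => ((hdr s).sub_const 1).div_const _)
    (fun s => by
      refine ((((hasDerivAt_id s).const_mul (κ ^ 2)).div (hdr s) (hsq s).ne').div_const
        (c - 1)).congr_deriv ?_
      have h3 := hsq s
      have h4 := hsq2 s
      simp only [id]
      field_simp
      rw [h4]
      ring)
    (by
      refine (Continuous.div continuous_const (by fun_prop) fun s => ?_).div_const _
      exact (pow_pos (hsq s) 3).ne')
    (fun s => div_nonneg (div_nonneg (by positivity) (by positivity)) (by linarith))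
    (by simp)
    (by
      have : √(1 + κ ^ 2 * 1 ^ 2) = c := by
        rw [one_pow, mul_one, ← hcκ, Real.sqrt_sq hc0.le]
      simp only [this]
      field_simp)
    (fun s => by simp only [neg_sq]; ring)
    (fun s hs => by
      have h3 := hsq s
      have h4 := hsq2 s
      rw [le_div_iff₀ (by linarith)]
      have h5 : √(1 + κ ^ 2 * s ^ 2) ≤ c := by
        refine abs_le_of_sq_le_sq' ?_ hc0.le |>.2
        rw [h4, hcκ]
        have : s ^ 2 ≤ 1 := pow_le_one₀ hs.1 hs.2
        nlinarith [sq_nonneg κ]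
      have h6 : 1 ≤ √(1 + κ ^ 2 * s ^ 2) := Real.one_le_sqrt.2 (by nlinarith [sq_nonneg (κ * s)])
      generalize √(1 + κ ^ 2 * s ^ 2) = r at *
      -- Both sides are `κ ^ 2 * s ^ 2`; as `r ≤ c`, the hyperbola stays within the parabolic
      -- segment.
      have h7 : s ^ 2 * (c - 1) * (c + 1) = (r - 1) * (r + 1) := by linear_combination s ^ 2 * hcκ - h4
      refine le_of_mul_le_mul_right (a := c + 1) ?_ (by linarith)
      rw [h7]
      exact mul_le_mul_of_nonneg_left (by linarith) (by linarith))
    ?_ ?_ (hA ▸ h2) (hB ▸ h1)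
  · refine (measure_mono ?_).trans_lt key
    rintro _ ⟨t, ht, rfl⟩
    have ht0 : 0 < t := h0.trans_le ht.1
    obtain ⟨τ, hτ⟩ : ∃ τ, τ = t / g := ⟨_, rfl⟩
    obtain rfl : t = g * τ := by rw [hτ]; field_simp
    have hτ0 : 0 < τ := by rw [hτ]; positivity
    have hτ1 : τ ≤ θ := le_of_mul_le_mul_left ht.2 hg
    have hτ2 : θ⁻¹ ≤ τ := by
      refine le_of_mul_le_mul_left ?_ hg
      rw [← div_eq_mul_inv]; exact ht.1
    have hτ3 : τ⁻¹ ≤ θ := by rw [inv_le_comm₀ hτ0 hθ0]; exact hτ2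
    have hτ4 : θ⁻¹ ≤ τ⁻¹ := inv_anti₀ hτ0 hτ1
    refine ⟨(τ - τ⁻¹) / (2 * κ), ⟨?_, ?_⟩, ?_⟩
    · rw [le_div_iff₀ (by positivity), hκ]; linarith
    · rw [div_le_iff₀ (by positivity), hκ]; linarith
    · have hr : √(1 + κ ^ 2 * ((τ - τ⁻¹) / (2 * κ)) ^ 2) = (τ + τ⁻¹) / 2 := by
        rw [← Real.sqrt_sq (show 0 ≤ (τ + τ⁻¹) / 2 by positivity)]
        congr 1
        field_simp
        ring
      simp only [hr]
      have e1 : (τ - τ⁻¹) / (2 * κ) * κ = (τ - τ⁻¹) / 2 := by field_simp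
      have e2 : ((τ + τ⁻¹) / 2 - 1) / (c - 1) * (c - 1) = (τ + τ⁻¹) / 2 - 1 := by field_simp
      rw [smul_smul, smul_smul, e1, e2, mul_inv]
      module
  · intro hD
    refine hinj hlt ?_
    rw [← hA, ← hB, hD, add_zero, sub_zero]
  · have := hle g ⟨div_le_self hg.le hθ.le, le_mul_of_one_le_right hg.le hθ.le⟩
    rwa [add_assoc] at this

theorem length_hyperbola_arc_lt {C U W : E} {t₁ t₂ : ℝ} (h0 : 0 < t₁ ∨ t₂ < 0) (h12 : t₁ ≤ t₂)
    (h1 : ‖C + t₁ • U + t₁⁻¹ • W‖ = 1) (h2 : ‖C + t₂ • U + t₂⁻¹ • W‖ = 1)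
    (hle : ∀ t ∈ Set.Icc t₁ t₂, ‖C + t • U + t⁻¹ • W‖ ≤ 1)
    (hinj : t₁ < t₂ → C + t₁ • U + t₁⁻¹ • W ≠ C + t₂ • U + t₂⁻¹ • W) :
    μH[1] ((fun t : ℝ => C + t • U + t⁻¹ • W) '' Set.Icc t₁ t₂) < ENNReal.ofReal 4.002671 := by
  rcases h0 with h0 | h0
  · exact length_hyperbola_arc_lt_of_pos h0 h12 h1 h2 hle hinj
  · have e : ∀ t : ℝ, C + (-t) • (-U) + (-t)⁻¹ • (-W) = C + t • U + t⁻¹ • W := by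
      intro t
      rw [inv_neg]; module
    rw [image_hyperbola_neg]
    refine length_hyperbola_arc_lt_of_pos (by linarith) (by linarith) (by rw [e, h2])
      (by rw [e, h1]) (fun t ht => ?_) (fun h => ?_)
    · have := hle (-t) ⟨by linarith [ht.2], by linarith [ht.1]⟩
      rwa [← e, neg_neg] at this
    · rw [e, e]
      exact (hinj (by linarith)).symm

end SingleArc

/-! ### Two arcs on the same branch of a hyperbola -/

theorem inner_plane (x y : Plane) : inner ℝ x y = x 0 * y 0 + x 1 * y 1 := by
  simp [PiLp.inner_apply, Fin.sum_univ_two, mul_comm]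

/-- Coordinates of a vector of the plane with respect to an orthogonal basis. -/
theorem norm_sq_eq_of_orthogonal {C P N : Plane} (hP : P ≠ 0) (hN : N ≠ 0)
    (h : inner ℝ P N = 0) :
    (inner ℝ C P / ‖P‖) ^ 2 + (inner ℝ C N / ‖N‖) ^ 2 = ‖C‖ ^ 2 := by
  have hp : 0 < ‖P‖ := norm_pos_iff.2 hP
  have hn : 0 < ‖N‖ := norm_pos_iff.2 hN
  have key : inner ℝ C P ^ 2 * ‖N‖ ^ 2 + inner ℝ C N ^ 2 * ‖P‖ ^ 2 =
      ‖C‖ ^ 2 * ‖P‖ ^ 2 * ‖N‖ ^ 2 := by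
    rw [← real_inner_self_eq_norm_sq, ← real_inner_self_eq_norm_sq, ← real_inner_self_eq_norm_sq]
    simp only [inner_plane] at h ⊢
    linear_combination (2 * (C 0 * P 0 + C 1 * P 1) * (C 0 * N 0 + C 1 * N 1) -
      (C 0 ^ 2 + C 1 ^ 2) * (P 0 * N 0 + P 1 * N 1)) * h
  field_simp
  linear_combination key

theorem sub_inv_div_two_mono {s t : ℝ} (hs : 0 < s) (hst : s ≤ t) :
    (s - s⁻¹) / 2 ≤ (t - t⁻¹) / 2 := by
  have := inv_anti₀ hs hst
  linarith

theorem sqrt_one_add_sub_inv_sq {t : ℝ} (ht : 0 < t) :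
    √(1 + ((t - t⁻¹) / 2) ^ 2) = (t + t⁻¹) / 2 := by
  rw [← Real.sqrt_sq (show 0 ≤ (t + t⁻¹) / 2 by positivity)]
  congr 1
  field_simp
  ring

theorem exists_sub_inv_eq (y : ℝ) : ∃ t : ℝ, 0 < t ∧ (t - t⁻¹) / 2 = y := by
  have h2 : √(1 + y ^ 2) ^ 2 = 1 + y ^ 2 := Real.sq_sqrt (by positivity)
  have h1 : |y| < √(1 + y ^ 2) := by
    rw [← Real.sqrt_sq_eq_abs]
    exact Real.sqrt_lt_sqrt (by positivity) (by linarith)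
  have h0 : 0 < y + √(1 + y ^ 2) := by linarith [neg_abs_le y]
  refine ⟨y + √(1 + y ^ 2), h0, ?_⟩
  have : (y + √(1 + y ^ 2))⁻¹ = √(1 + y ^ 2) - y :=
    inv_eq_of_mul_eq_one_right (by linear_combination h2)
  rw [this]; ring

/-- The arc of a branch of a hyperbola with axes `P`, `N` over an interval is at most as long as
the arc of a parabola with the same endpoints which lies on its convex side. -/
theorem length_hyperbola_arc_le_integral {C P N : Plane} (hN : N ≠ 0)
    (hPN : inner ℝ P N = 0) {a b : ℝ} (hab : a ≤ b) {Y Y' : ℝ → ℝ}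
    (hY : ∀ t, HasDerivAt Y (Y' t) t) (hcY : Continuous Y')
    (hle : ∀ t ∈ Set.Icc a b, Y t ≤ √(1 + t ^ 2)) (ha : Y a = √(1 + a ^ 2))
    (hb : Y b = √(1 + b ^ 2)) :
    μH[1] ((fun t : ℝ => C + √(1 + t ^ 2) • P + t • N) '' Set.Icc a b) ≤
      ENNReal.ofReal (∫ t in a..b, √(‖N‖ ^ 2 + (‖P‖ * Y' t) ^ 2)) := by
  have hn : 0 < ‖N‖ := norm_pos_iff.2 hN
  have hs : ∀ t : ℝ, 0 < √(1 + t ^ 2) := fun t => Real.sqrt_pos.2 (by positivity)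
  have hs2 : ∀ t : ℝ, √(1 + t ^ 2) ^ 2 = 1 + t ^ 2 := fun t => Real.sq_sqrt (by positivity)
  have hd : ∀ t : ℝ, HasDerivAt (fun t => √(1 + t ^ 2)) (t / √(1 + t ^ 2)) t := by
    intro t
    have : HasDerivAt (fun t : ℝ => 1 + t ^ 2) (2 * t) t := by
      simpa using (hasDerivAt_pow 2 t).const_add (1 : ℝ)
    refine (this.sqrt (by positivity)).congr_deriv ?_
    have := hs t
    field_simp
  have hc1 : Continuous fun t : ℝ => t / √(1 + t ^ 2) :=
    continuous_id.div (by fun_prop) fun t => (hs t).ne'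
  have hcγ : Continuous fun t : ℝ => (t / √(1 + t ^ 2)) • P + N := by fun_prop
  refine (hausdorffMeasure_image_Icc_le_integral (γ' := fun t => (t / √(1 + t ^ 2)) • P + N) hab
    (fun t _ => ?_) hcγ.continuousOn).trans (ENNReal.ofReal_le_ofReal ?_)
  · refine (((hd t).smul_const P).const_add C).add ?_
    simpa using (hasDerivAt_id t).smul_const N
  have hnorm : ∀ t : ℝ, ‖(t / √(1 + t ^ 2)) • P + N‖ =
      √(‖N‖ ^ 2 + (‖P‖ * (t / √(1 + t ^ 2))) ^ 2) := by
    intro t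
    rw [← Real.sqrt_sq (norm_nonneg ((t / √(1 + t ^ 2)) • P + N)), norm_add_sq_real,
      real_inner_smul_left, hPN, norm_smul, mul_pow, Real.norm_eq_abs, sq_abs]
    congr 1
    ring
  simp only [hnorm]
  refine integral_sqrt_le_of_convex (X := fun t => ‖P‖ * √(1 + t ^ 2))
    (X'' := fun t => ‖P‖ * (1 / √(1 + t ^ 2) ^ 3)) (Y := fun t => ‖P‖ * Y t) hn hab
    (fun t => (hd t).const_mul _) (fun t => ?_) ?_ (fun t => by have := hs t; positivity)
    (fun t => (hY t).const_mul _) (by fun_prop)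
    (fun t ht => mul_le_mul_of_nonneg_left (hle t ht) (norm_nonneg _)) (by simp only [ha])
    (by simp only [hb])
  · refine (((hasDerivAt_id t).div (hd t) (hs t).ne').const_mul ‖P‖).congr_deriv ?_
    have h3 := hs t
    have h4 := hs2 t
    simp only [id]
    field_simp
    rw [h4]
    ring
  · exact continuous_const.mul (continuous_const.div (by fun_prop)
      fun t => (pow_pos (hs t) 3).ne')

/-- Equal norms make the axes `P = U + W` and `N = U - W` orthogonal, and the branch is `C + x • P +
y • N` with `y = (t - t⁻¹) / 2`, `x = √(1 + y ^ 2)`. There `‖z‖ ^ 2 - 1 = G y - 2 * c * x` with `G`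
quadratic. So the parabola `x = G y / (2 * c)` passes through the four points and lies on the convex
side of the branch inside the disc. -/
theorem length_same_branch_lt_of_norm_eq {C U W : Plane} {t₁ t₂ t₃ t₄ : ℝ} (h1 : 0 < t₁)
    (h12 : t₁ ≤ t₂) (h23 : t₂ < t₃) (h34 : t₃ ≤ t₄) (hprod : t₁ * t₂ * t₃ * t₄ = 1)
    (hUW : ‖U‖ = ‖W‖) (hP : U + W ≠ 0) (hN : U - W ≠ 0)
    (hpoly : ∀ t : ℝ, ‖U‖ ^ 2 * t ^ 4 + 2 * inner ℝ C U * t ^ 3 +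
      (‖C‖ ^ 2 + 2 * inner ℝ U W - 1) * t ^ 2 + 2 * inner ℝ C W * t + ‖W‖ ^ 2 =
      ‖U‖ ^ 2 * ((t - t₁) * (t - t₂) * (t - t₃) * (t - t₄))) :
    μH[1] ((fun t : ℝ => C + t • U + t⁻¹ • W) '' Set.Icc t₁ t₂) +
      μH[1] ((fun t : ℝ => C + t • U + t⁻¹ • W) '' Set.Icc t₃ t₄) <
        ENNReal.ofReal 4.002671 := by
  have h2 : 0 < t₂ := h1.trans_le h12
  have h3 : 0 < t₃ := h2.trans h23
  have h4 : 0 < t₄ := h3.trans_le h34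
  have hPN : inner ℝ (U + W) (U - W) = 0 := by
    rw [inner_add_left, inner_sub_right, inner_sub_right, real_inner_self_eq_norm_sq,
      real_inner_self_eq_norm_sq, hUW, real_inner_comm U W]
    ring
  have hp : 0 < ‖U + W‖ := norm_pos_iff.2 hP
  have hn : 0 < ‖U - W‖ := norm_pos_iff.2 hN
  have hp2 : ‖U + W‖ ^ 2 = 2 * ‖U‖ ^ 2 + 2 * inner ℝ U W := by
    rw [norm_add_sq_real, ← hUW]; ring
  have hn2 : ‖U - W‖ ^ 2 = 2 * ‖U‖ ^ 2 - 2 * inner ℝ U W := by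
    rw [norm_sub_sq_real, ← hUW]; ring
  have hC := norm_sq_eq_of_orthogonal (C := C) hP hN hPN
  have hCP : inner ℝ C (U + W) = inner ℝ C U + inner ℝ C W := inner_add_right _ _ _
  have hCN : inner ℝ C (U - W) = inner ℝ C U - inner ℝ C W := inner_sub_right _ _ _
  rw [← hUW] at hpoly
  obtain ⟨u, hu⟩ : ∃ u, u = ‖U‖ ^ 2 := ⟨_, rfl⟩
  obtain ⟨p, hpp⟩ : ∃ p, p = ‖U + W‖ := ⟨_, rfl⟩
  obtain ⟨n, hnn⟩ : ∃ n, n = ‖U - W‖ := ⟨_, rfl⟩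
  obtain ⟨c, hc⟩ : ∃ c, c = -inner ℝ C (U + W) := ⟨_, rfl⟩
  obtain ⟨ν, hν⟩ : ∃ ν, ν = inner ℝ C (U - W) := ⟨_, rfl⟩
  obtain ⟨m, hm⟩ : ∃ m, m = ‖C‖ ^ 2 := ⟨_, rfl⟩
  have hcu : 2 * inner ℝ C U = ν - c := by rw [hν, hc, hCP, hCN]; ring
  have hcw : 2 * inner ℝ C W = -c - ν := by rw [hν, hc, hCP, hCN]; ring
  have hCP' : inner ℝ C (U + W) = -c := by rw [hc]; ring
  have huw : 2 * inner ℝ U W = p ^ 2 - 2 * u := by rw [hpp, hp2, hu]; ring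
  rw [← hpp, ← hu, huw] at hp2
  rw [← hnn, ← hu, huw] at hn2
  rw [← hpp] at hp
  rw [← hnn] at hn
  rw [← hpp, ← hnn, ← hν, ← hm, hCP'] at hC
  simp only [← hu, hcu, hcw, huw, ← hm] at hpoly
  have hu0 : 0 < u := by nlinarith [pow_pos hp 2, pow_pos hn 2]
  -- the parabola in the pencil of the hyperbola and the circle
  obtain ⟨G, hG⟩ : ∃ G : ℝ → ℝ, G = fun y => 4 * u * y ^ 2 + 2 * ν * y + (m + p ^ 2 - 1) :=
    ⟨_, rfl⟩
  have hGpoly : ∀ t : ℝ, t ≠ 0 → t ^ 2 * (G ((t - t⁻¹) / 2) - 2 * c * ((t + t⁻¹) / 2)) =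
      u * ((t - t₁) * (t - t₂) * (t - t₃) * (t - t₄)) := by
    intro t ht
    rw [← hpoly, hG]
    field_simp
    ring
  have hc0 : 0 < c := by
    have q1 := hpoly 1
    have q2 := hpoly (-1)
    have : 2 * c = u * (t₁ + t₂ + t₃ + t₄ + (t₁ * t₂ * t₃ + t₁ * t₂ * t₄ + t₁ * t₃ * t₄ +
        t₂ * t₃ * t₄)) := by
      linear_combination (-1 / 2) * q1 + (1 / 2) * q2
    have : 0 < u * (t₁ + t₂ + t₃ + t₄ + (t₁ * t₂ * t₃ + t₁ * t₂ * t₄ + t₁ * t₃ * t₄ +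
        t₂ * t₃ * t₄)) := by positivity
    linarith
  obtain ⟨Y, hYdef⟩ : ∃ Y : ℝ → ℝ, Y = fun y => G y / (2 * c) := ⟨_, rfl⟩
  obtain ⟨q, hq⟩ : ∃ q, q = 2 * p * u / c := ⟨_, rfl⟩
  obtain ⟨y₀, hy₀⟩ : ∃ y₀, y₀ = ν / (4 * u) := ⟨_, rfl⟩
  have hq0 : 0 < q := by rw [hq]; positivity
  have hY : ∀ t, HasDerivAt Y ((8 * u * t + 2 * ν) / (2 * c)) t := by
    intro t
    rw [hYdef, hG]
    refine (((((hasDerivAt_pow 2 t).const_mul (4 * u)).add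
      ((hasDerivAt_id t).const_mul (2 * ν))).add_const (m + p ^ 2 - 1)).div_const
      (2 * c)).congr_deriv ?_
    norm_num
    ring
  have hspeed : ∀ t, p * ((8 * u * t + 2 * ν) / (2 * c)) = 2 * q * (t + y₀) := by
    intro t
    rw [hq, hy₀]
    field_simp
    ring
  have hYt : ∀ t : ℝ, 0 < t → Y ((t - t⁻¹) / 2) - √(1 + ((t - t⁻¹) / 2) ^ 2) =
      u * ((t - t₁) * (t - t₂) * (t - t₃) * (t - t₄)) / (2 * c * t ^ 2) := by
    intro t ht
    rw [sqrt_one_add_sub_inv_sq ht, ← hGpoly t ht.ne', hYdef]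
    field_simp
  have harc : ∀ a b : ℝ, 0 < a → a ≤ b →
      (a - t₁) * (a - t₂) * (a - t₃) * (a - t₄) = 0 →
      (b - t₁) * (b - t₂) * (b - t₃) * (b - t₄) = 0 →
      (∀ t ∈ Set.Icc a b, (t - t₁) * (t - t₂) * (t - t₃) * (t - t₄) ≤ 0) →
      μH[1] ((fun t : ℝ => C + t • U + t⁻¹ • W) '' Set.Icc a b) ≤
        ENNReal.ofReal (∫ t in ((a - a⁻¹) / 2 + y₀)..((b - b⁻¹) / 2 + y₀),
          √(n ^ 2 + (2 * q * t) ^ 2)) := by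
    intro a b ha hab ea eb hle
    have hb : 0 < b := ha.trans_le hab
    have := length_hyperbola_arc_le_integral (C := C) (P := U + W) (N := U - W) hN hPN
      (sub_inv_div_two_mono ha hab) hY (by fun_prop) (fun y hy => ?_)
      (by rw [← sub_eq_zero, hYt a ha, ea]; simp) (by rw [← sub_eq_zero, hYt b hb, eb]; simp)
    · rw [← hpp, ← hnn] at this
      simp only [hspeed] at this
      rw [intervalIntegral.integral_comp_add_right
        (fun t => √(n ^ 2 + (2 * q * t) ^ 2))] at this
      refine (measure_mono ?_).trans this
      rintro _ ⟨t, ht, rfl⟩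
      have ht0 : 0 < t := ha.trans_le ht.1
      refine ⟨(t - t⁻¹) / 2, ⟨sub_inv_div_two_mono ha ht.1, sub_inv_div_two_mono ht0 ht.2⟩, ?_⟩
      simp only [sqrt_one_add_sub_inv_sq ht0]
      module
    · obtain ⟨t, ht0, rfl⟩ := exists_sub_inv_eq y
      have hat : a ≤ t := by
        by_contra! h
        have := inv_strictAnti₀ ht0 h
        linarith [hy.1]
      have htb : t ≤ b := by
        by_contra! h
        have := inv_strictAnti₀ hb h
        linarith [hy.2]
      rw [← sub_nonpos, hYt t ht0]
      exact div_nonpos_of_nonpos_of_nonneg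
        (mul_nonpos_of_nonneg_of_nonpos hu0.le (hle t ⟨hat, htb⟩)) (by positivity)
  have b1 := harc t₁ t₂ h1 h12 (by ring) (by ring) fun t ht => by
    have e1 : 0 ≤ (t - t₁) := by linarith [ht.1]
    have e2 : (t - t₂) ≤ 0 := by linarith [ht.2]
    have e3 : (t - t₃) ≤ 0 := by linarith [ht.2]
    have e4 : (t - t₄) ≤ 0 := by linarith [ht.2]
    exact mul_nonpos_of_nonneg_of_nonpos (mul_nonneg_of_nonpos_of_nonpos
      (mul_nonpos_of_nonneg_of_nonpos e1 e2) e3) e4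
  have b2 := harc t₃ t₄ h3 h34 (by ring) (by ring) fun t ht => by
    have e1 : 0 ≤ (t - t₁) := by linarith [ht.1]
    have e2 : 0 ≤ (t - t₂) := by linarith [ht.1]
    have e3 : 0 ≤ (t - t₃) := by linarith [ht.1]
    have e4 : (t - t₄) ≤ 0 := by linarith [ht.2]
    exact mul_nonpos_of_nonneg_of_nonpos (by positivity) e4
  refine (add_le_add b1 b2).trans_lt ?_
  have hm12 := sub_inv_div_two_mono h1 h12
  have hm34 := sub_inv_div_two_mono h3 h34
  have hm23 : (t₂ - t₂⁻¹) / 2 < (t₃ - t₃⁻¹) / 2 := by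
    have := inv_strictAnti₀ h2 h23
    linarith
  rw [← ENNReal.ofReal_add
    (intervalIntegral.integral_nonneg (by linarith) fun _ _ => Real.sqrt_nonneg _)
    (intervalIntegral.integral_nonneg (by linarith) fun _ _ => Real.sqrt_nonneg _),
    ENNReal.ofReal_lt_ofReal_iff (by norm_num)]
  -- `h` and `k` are the coordinates of the centre of the disc relative to the vertex of the
  -- parabola, along the unit vectors of `P` and `N`.
  refine integral_sqrt_add_integral_sqrt_lt (h := c / p - p / (2 * c) * (m + p ^ 2 - 1 - ν ^ 2 / (4 * u)))
    (k := n * y₀ - ν / n) hn hq0 (by linarith) (by linarith) (by linarith) fun y => ?_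
  obtain ⟨t, ht0, ht⟩ := exists_sub_inv_eq (y - y₀)
  obtain rfl : y = (t - t⁻¹) / 2 + y₀ := by linarith
  have g1 := hGpoly t ht0.ne'
  -- The substitution `t ↦ -t⁻¹` fixes `y` and changes the sign of `x`; multiplying the two
  -- identities eliminates the square root.
  have g2 := hGpoly (-t⁻¹) (neg_ne_zero.2 (inv_ne_zero ht0.ne'))
  have hGG : G ((t - t⁻¹) / 2) ^ 2 - 4 * c ^ 2 * (1 + ((t - t⁻¹) / 2) ^ 2) =
      16 * u ^ 2 * (((t - t⁻¹) / 2 - (t₁ - t₁⁻¹) / 2) * ((t - t⁻¹) / 2 - (t₂ - t₂⁻¹) / 2) *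
        ((t - t⁻¹) / 2 - (t₃ - t₃⁻¹) / 2) * ((t - t⁻¹) / 2 - (t₄ - t₄⁻¹) / 2)) := by
    have i1 : (-t⁻¹ - (-t⁻¹)⁻¹) / 2 = (t - t⁻¹) / 2 := by rw [inv_neg, inv_inv]; ring
    have i2 : (-t⁻¹ + (-t⁻¹)⁻¹) / 2 = -((t + t⁻¹) / 2) := by rw [inv_neg, inv_inv]; ring
    rw [i1, i2] at g2
    have hf : ∀ s : ℝ, 0 < s → (t - s) * (-t⁻¹ - s) =
        -(2 * s) * ((t - t⁻¹) / 2 - (s - s⁻¹) / 2) := by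
      intro s hs
      field_simp
      ring
    have htt : t * t⁻¹ = 1 := mul_inv_cancel₀ ht0.ne'
    calc G ((t - t⁻¹) / 2) ^ 2 - 4 * c ^ 2 * (1 + ((t - t⁻¹) / 2) ^ 2)
        = (t ^ 2 * (G ((t - t⁻¹) / 2) - 2 * c * ((t + t⁻¹) / 2))) *
          ((-t⁻¹) ^ 2 * (G ((t - t⁻¹) / 2) - 2 * c * -((t + t⁻¹) / 2))) := by
          generalize G ((t - t⁻¹) / 2) = g
          field_simp
          ring
      _ = u ^ 2 * (((t - t₁) * (-t⁻¹ - t₁)) * ((t - t₂) * (-t⁻¹ - t₂)) *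
          ((t - t₃) * (-t⁻¹ - t₃)) * ((t - t₄) * (-t⁻¹ - t₄))) := by
          rw [g1, g2]; ring
      _ = _ := by
          rw [hf t₁ h1, hf t₂ h2, hf t₃ h3, hf t₄ h4]
          linear_combination 16 * u ^ 2 *
            (((t - t⁻¹) / 2 - (t₁ - t₁⁻¹) / 2) * ((t - t⁻¹) / 2 - (t₂ - t₂⁻¹) / 2) *
            ((t - t⁻¹) / 2 - (t₃ - t₃⁻¹) / 2) * ((t - t⁻¹) / 2 - (t₄ - t₄⁻¹) / 2)) * hprod
  have hlhs : (q * ((t - t⁻¹) / 2 + y₀) ^ 2 - (c / p - p / (2 * c) *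
      (m + p ^ 2 - 1 - ν ^ 2 / (4 * u)))) ^ 2 +
      (n * ((t - t⁻¹) / 2 + y₀) - (n * y₀ - ν / n)) ^ 2 - 1 =
      (p / (2 * c)) ^ 2 *
        (G ((t - t⁻¹) / 2) ^ 2 - 4 * c ^ 2 * (1 + ((t - t⁻¹) / 2) ^ 2)) := by
    generalize (t - t⁻¹) / 2 = y
    have k1 : q * (y + y₀) ^ 2 - (c / p - p / (2 * c) * (m + p ^ 2 - 1 - ν ^ 2 / (4 * u))) =
        p / (2 * c) * G y - c / p := by
      rw [hq, hy₀, hG]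
      field_simp
      ring
    have k2 : n * (y + y₀) - (n * y₀ - ν / n) = n * y + ν / n := by ring
    have k3 : p / (2 * c) * G y * (c / p) = G y / 2 := by field_simp
    have k4 : n * y * (ν / n) = ν * y := by field_simp
    have k5 : G y = 4 * u * y ^ 2 + 2 * ν * y + (m + p ^ 2 - 1) := by rw [hG]
    have k6 : (p / (2 * c)) ^ 2 * (4 * c ^ 2) = p ^ 2 := by field_simp; norm_num
    rw [k1, k2]
    linear_combination -2 * k3 + 2 * k4 - k5 + hC + y ^ 2 * hn2 + (1 + y ^ 2) * k6
  rw [hlhs, hGG, hq]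
  field_simp
  ring

/-- Rescaling the parameter by `l = √(‖W‖ / ‖U‖)` makes the two vectors equally long; comparing
constant coefficients, the rescaled roots have product 1. -/
theorem length_same_branch_lt {C U W : Plane} {t₁ t₂ t₃ t₄ : ℝ} (h1 : 0 < t₁)
    (h12 : t₁ ≤ t₂) (h23 : t₂ < t₃) (h34 : t₃ ≤ t₄) (hU : U ≠ 0) (hlin : ∀ r : ℝ, W ≠ r • U)
    (hpoly : ∀ t : ℝ, ‖U‖ ^ 2 * t ^ 4 + 2 * inner ℝ C U * t ^ 3 +
      (‖C‖ ^ 2 + 2 * inner ℝ U W - 1) * t ^ 2 + 2 * inner ℝ C W * t + ‖W‖ ^ 2 =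
      ‖U‖ ^ 2 * ((t - t₁) * (t - t₂) * (t - t₃) * (t - t₄))) :
    μH[1] ((fun t : ℝ => C + t • U + t⁻¹ • W) '' Set.Icc t₁ t₂) +
      μH[1] ((fun t : ℝ => C + t • U + t⁻¹ • W) '' Set.Icc t₃ t₄) <
        ENNReal.ofReal 4.002671 := by
  have hu : 0 < ‖U‖ := norm_pos_iff.2 hU
  have hw : 0 < ‖W‖ := norm_pos_iff.2 fun h => hlin 0 (by rw [h, zero_smul])
  obtain ⟨l, hl⟩ : ∃ l, l = √(‖W‖ / ‖U‖) := ⟨_, rfl⟩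
  have hl0 : 0 < l := by rw [hl]; exact Real.sqrt_pos.2 (by positivity)
  have hl2 : l ^ 2 * ‖U‖ = ‖W‖ := by
    rw [hl, Real.sq_sqrt (by positivity)]; field_simp
  have hnU : ‖l • U‖ = l * ‖U‖ := by rw [norm_smul, Real.norm_of_nonneg hl0.le]
  have hnW : ‖l⁻¹ • W‖ = l * ‖U‖ := by
    rw [norm_smul, Real.norm_of_nonneg (by positivity), ← hl2]; field_simp
  have himage : ∀ a b : ℝ, (fun t : ℝ => C + t • U + t⁻¹ • W) '' Set.Icc a b ⊆
      (fun t : ℝ => C + t • (l • U) + t⁻¹ • (l⁻¹ • W)) '' Set.Icc (a / l) (b / l) := by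
    rintro a b _ ⟨t, ht, rfl⟩
    refine ⟨t / l, ⟨by have := ht.1; gcongr, by have := ht.2; gcongr⟩, ?_⟩
    have e1 : t / l * l = t := by field_simp
    have e2 : (t / l)⁻¹ * l⁻¹ = t⁻¹ := by rw [← mul_inv, e1]
    simp only [smul_smul, e1, e2]
  refine (add_le_add (measure_mono (himage _ _)) (measure_mono (himage _ _))).trans_lt ?_
  refine length_same_branch_lt_of_norm_eq (by positivity) (by gcongr) (by gcongr) (by gcongr) ?_
    (hnU.trans hnW.symm) ?_ ?_ ?_
  · have h0 := hpoly 0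
    have : ‖U‖ ^ 2 * (t₁ * t₂ * t₃ * t₄) = ‖U‖ ^ 2 * l ^ 4 := by
      rw [← hl2] at h0
      linear_combination -h0
    have := mul_left_cancel₀ (by positivity) this
    field_simp
    exact this
  · intro h
    refine hlin (-(l * l)) ?_
    have : W = l • (l⁻¹ • W) := by rw [smul_smul, mul_inv_cancel₀ hl0.ne', one_smul]
    rw [this, eq_neg_of_add_eq_zero_right h]
    module
  · intro h
    refine hlin (l * l) ?_
    have : W = l • (l⁻¹ • W) := by rw [smul_smul, mul_inv_cancel₀ hl0.ne', one_smul]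
    rw [this, ← sub_eq_zero.1 h]
    module
  · intro t
    have := hpoly (l * t)
    have e : ∀ s, l * t - s = l * (t - s / l) := fun s => by field_simp
    rw [e, e, e, e, ← hl2] at this
    rw [hnU, hnW, inner_smul_right, inner_smul_right, real_inner_smul_left, inner_smul_right]
    refine mul_left_cancel₀ (pow_ne_zero 2 hl0.ne') ?_
    have e2 : l * l⁻¹ = 1 := mul_inv_cancel₀ hl0.ne'
    linear_combination this + (2 * inner ℝ C W * t * l + 2 * inner ℝ U W * t ^ 2 * l ^ 2) * e2

/-! ### The whole hyperbola -/

theorem mem_of_prod_nonpos {t t₁ t₂ t₃ t₄ : ℝ} (h12 : t₁ ≤ t₂) (h23 : t₂ < t₃) (h34 : t₃ ≤ t₄)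
    (h : (t - t₁) * (t - t₂) * (t - t₃) * (t - t₄) ≤ 0) :
    t ∈ Set.Icc t₁ t₂ ∪ Set.Icc t₃ t₄ := by
  by_contra hcon
  simp only [Set.mem_union, Set.mem_Icc, not_or, not_and_or, not_le] at hcon
  refine absurd h (not_le.2 ?_)
  have key : (t < t₁) ∨ (t₂ < t ∧ t < t₃) ∨ t₄ < t := by
    rcases hcon with ⟨h1 | h1, h2 | h2⟩
    · exact Or.inl h1
    · exact Or.inl h1
    · exact Or.inr (Or.inl ⟨h1, h2⟩)
    · exact Or.inr (Or.inr h2)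
  rcases key with h1 | ⟨h1, h2⟩ | h1
  · exact mul_pos_of_neg_of_neg (mul_neg_of_pos_of_neg (mul_pos_of_neg_of_neg (by linarith)
      (by linarith)) (by linarith)) (by linarith)
  · exact mul_pos_of_neg_of_neg (mul_neg_of_pos_of_neg (mul_pos (by linarith)
      (by linarith)) (by linarith)) (by linarith)
  · exact mul_pos (mul_pos (mul_pos (by linarith) (by linarith)) (by linarith)) (by linarith)

/-- The part of a hyperbola in the unit disc. -/
theorem length_hyperbola_lt {C U W : Plane} (hU : U ≠ 0) (hlin : ∀ r : ℝ, W ≠ r • U) :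
    μH[1] {z : Plane | ‖z‖ ≤ 1 ∧ ∃ t : ℝ, t ≠ 0 ∧ z = C + t • U + t⁻¹ • W} <
      ENNReal.ofReal 4.002671 := by
  have hu : 0 < ‖U‖ := norm_pos_iff.2 hU
  have hw : 0 < ‖W‖ := norm_pos_iff.2 fun h => hlin 0 (by rw [h, zero_smul])
  obtain ⟨R, hR⟩ : ∃ R : ℝ → ℝ, ∀ t, R t = ‖U‖ ^ 2 * t ^ 4 + 2 * inner ℝ C U * t ^ 3 +
      (‖C‖ ^ 2 + 2 * inner ℝ U W - 1) * t ^ 2 + 2 * inner ℝ C W * t + ‖W‖ ^ 2 := ⟨_, fun _ => rfl⟩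
  have hRz : ∀ t : ℝ, t ≠ 0 → R t = t ^ 2 * (‖C + t • U + t⁻¹ • W‖ ^ 2 - 1) := by
    intro t ht
    rw [norm_add_sq_real, norm_add_sq_real, norm_smul, norm_smul, inner_add_left,
      real_inner_smul_left, inner_smul_right, inner_smul_right, inner_smul_right, mul_pow, mul_pow,
      Real.norm_eq_abs, Real.norm_eq_abs, sq_abs, sq_abs, hR]
    field_simp
    ring
  have hle : ∀ t : ℝ, t ≠ 0 → (R t ≤ 0 ↔ ‖C + t • U + t⁻¹ • W‖ ≤ 1) := by
    intro t ht
    have : 0 < t ^ 2 := by positivity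
    rw [hRz t ht, ← sq_le_one_iff₀ (norm_nonneg _)]
    constructor
    · intro h
      by_contra! h'
      have := mul_pos this (sub_pos.2 h')
      linarith
    · intro h
      exact mul_nonpos_of_nonneg_of_nonpos this.le (by linarith)
  have heq : ∀ t : ℝ, t ≠ 0 → R t = 0 → ‖C + t • U + t⁻¹ • W‖ = 1 := by
    intro t ht h
    rw [hRz t ht] at h
    have := (mul_eq_zero.1 h).resolve_left (by positivity)
    rw [← sq_eq_sq₀ (norm_nonneg _) zero_le_one]
    linarith
  have hR0 : 0 < R 0 := by
    have : R 0 = ‖W‖ ^ 2 := by rw [hR]; ring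
    rw [this]; positivity
  have hinj : ∀ s t : ℝ, s ≠ 0 → t ≠ 0 → s < t →
      C + s • U + s⁻¹ • W ≠ C + t • U + t⁻¹ • W := by
    intro s t hs ht hst h
    have h2 : (t⁻¹ - s⁻¹) • W = (s - t) • U := by
      linear_combination (norm := module) -h
    have h3 : t⁻¹ - s⁻¹ ≠ 0 := fun h3 => hst.ne (inv_injective (by linarith))
    refine hlin ((t⁻¹ - s⁻¹)⁻¹ * (s - t)) ?_
    rw [mul_smul, ← h2, smul_smul, inv_mul_cancel₀ h3, one_smul]
  have hsub : ∀ K : Set ℝ, (∀ t, R t ≤ 0 → t ∈ K) →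
      {z : Plane | ‖z‖ ≤ 1 ∧ ∃ t : ℝ, t ≠ 0 ∧ z = C + t • U + t⁻¹ • W} ⊆
        (fun t : ℝ => C + t • U + t⁻¹ • W) '' K := by
    rintro K hK _ ⟨hz, t, ht, rfl⟩
    exact ⟨t, hK t ((hle t ht).2 hz), rfl⟩
  rcases quartic_nonpos_cases (R := R) (pow_pos hu 2) hR with
    hpos | ⟨t₁, t₂, h12, e1, e2, hiff⟩ | ⟨t₁, t₂, t₃, t₄, h12, h23, h34, hfac⟩
  · refine (measure_mono (hsub ∅ fun t ht => absurd (hpos t) (not_lt.2 ht))).trans_lt ?_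
    rw [Set.image_empty, measure_empty]
    exact ENNReal.ofReal_pos.2 (by norm_num)
  · have h0 : ∀ t, R t ≤ 0 → t ≠ 0 := by
      rintro t ht rfl
      exact absurd hR0 (not_lt.2 ht)
    have hn : 0 < t₁ ∨ t₂ < 0 := by
      by_contra! h
      exact absurd hR0 (not_lt.2 ((hiff 0).2 h))
    refine (measure_mono (hsub _ fun t => (hiff t).1)).trans_lt ?_
    exact length_hyperbola_arc_lt hn h12 (heq _ (h0 _ e1.le) e1) (heq _ (h0 _ e2.le) e2)
      (fun t ht => (hle t (h0 t ((hiff t).2 ht))).1 ((hiff t).2 ht))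
      (hinj _ _ (h0 _ e1.le) (h0 _ e2.le))
  · have hsub' := hsub (Set.Icc t₁ t₂ ∪ Set.Icc t₃ t₄) fun t ht =>
      mem_of_prod_nonpos h12 h23 h34 (by
        rw [hfac] at ht
        by_contra! h
        exact absurd ht (not_le.2 (mul_pos (by positivity) h)))
    rw [Set.image_union] at hsub'
    refine ((measure_mono hsub').trans (measure_union_le _ _)).trans_lt ?_
    have hpoly := fun t => (hR t).symm.trans (hfac t)
    rcases lt_or_ge 0 t₁ with hp | hp
    · exact length_same_branch_lt hp h12 h23 h34 hU hlin hpoly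
    rcases lt_or_ge t₄ 0 with hn | hn
    · have hpoly' : ∀ t : ℝ, ‖-U‖ ^ 2 * t ^ 4 + 2 * inner ℝ C (-U) * t ^ 3 +
          (‖C‖ ^ 2 + 2 * inner ℝ (-U) (-W) - 1) * t ^ 2 + 2 * inner ℝ C (-W) * t + ‖-W‖ ^ 2 =
          ‖-U‖ ^ 2 * ((t - -t₄) * (t - -t₃) * (t - -t₂) * (t - -t₁)) := by
        intro t
        simp only [norm_neg, inner_neg_right, inner_neg_left, neg_neg]
        linear_combination hpoly (-t)
      rw [image_hyperbola_neg C U W t₁ t₂, image_hyperbola_neg C U W t₃ t₄, add_comm]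
      exact length_same_branch_lt (neg_pos.2 hn) (neg_le_neg h34) (neg_lt_neg h23)
        (neg_le_neg h12) (neg_ne_zero.2 hU)
        (fun r h => hlin r (by rw [← neg_inj, h, smul_neg])) hpoly'
    -- `R 0 = ‖W‖ ^ 2 > 0` makes the product of the roots positive; with `t₁ ≤ 0 ≤ t₄` this forces
    -- two roots of each sign, hence one arc on each branch.
    · have hne : 0 < ‖U‖ ^ 2 * (t₁ * t₂ * t₃ * t₄) := by
        rw [hfac] at hR0
        linarith
      have hne' : 0 < (t₁ * t₄) * (t₂ * t₃) := by
        have := (mul_pos_iff_of_pos_left (pow_pos hu 2)).1 hne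
        linarith
      have h14 : t₁ * t₄ ≤ 0 := mul_nonpos_of_nonpos_of_nonneg hp hn
      have h23' : t₂ * t₃ < 0 := by
        by_contra! h
        nlinarith
      have h2 : t₂ < 0 := by
        by_contra! h
        nlinarith
      have h3 : 0 < t₃ := by
        by_contra! h
        nlinarith
      refine (length_opposite_branches_le h12 h2 h3 h34 ?_).trans_lt
        ((ENNReal.ofReal_lt_ofReal_iff (by norm_num)).2 (by norm_num))
      intro t ht
      simp only [Set.mem_insert_iff, Set.mem_singleton_iff] at ht
      rcases ht with rfl | rfl | rfl | rfl
      · exact (heq _ (by linarith) (by rw [hfac]; ring)).le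
      · exact (heq _ h2.ne (by rw [hfac]; ring)).le
      · exact (heq _ h3.ne' (by rw [hfac]; ring)).le
      · exact (heq _ (by linarith) (by rw [hfac]; ring)).le

/-! ### Parabolas, lines and the classification of the conics -/

theorem norm_sq_plane (z : Plane) : ‖z‖ ^ 2 = z 0 ^ 2 + z 1 ^ 2 := by
  rw [← real_inner_self_eq_norm_sq, inner_plane]; ring

theorem mem_disc_iff {z : Plane} : z ∈ disc ↔ ‖z‖ ≤ 1 := mem_closedBall_zero_iff

theorem plane_ext {z w : Plane} (h0 : z 0 = w 0) (h1 : z 1 = w 1) : z = w := by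
  ext i
  fin_cases i
  · exact h0
  · exact h1

/-- The part of a parabola in the unit disc. -/
theorem length_parabola_lt {α β γ : ℝ} (hα : α ≠ 0) :
    length {z : Plane | z ∈ disc ∧ z 1 = γ + β * z 0 + α * z 0 ^ 2} <
      ENNReal.ofReal 4.002671 := by
  obtain ⟨C, hC⟩ : ∃ C : Plane, C = !₂[0, γ] := ⟨_, rfl⟩
  obtain ⟨U, hU⟩ : ∃ U : Plane, U = !₂[1, β] := ⟨_, rfl⟩
  obtain ⟨W, hW⟩ : ∃ W : Plane, W = !₂[0, α] := ⟨_, rfl⟩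
  have hz0 : ∀ t : ℝ, (C + t • U + t ^ 2 • W) 0 = t := by intro t; simp [hC, hU, hW]
  have hz1 : ∀ t : ℝ, (C + t • U + t ^ 2 • W) 1 = γ + β * t + α * t ^ 2 := by
    intro t; simp [hC, hU, hW]; ring
  have hn : ∀ t : ℝ, ‖C + t • U + t ^ 2 • W‖ ^ 2 = t ^ 2 + (γ + β * t + α * t ^ 2) ^ 2 := by
    intro t
    rw [norm_sq_plane, hz0, hz1]
  set R : ℝ → ℝ := fun t => t ^ 2 + (γ + β * t + α * t ^ 2) ^ 2 - 1 with hR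
  have hle : ∀ t, R t ≤ 0 ↔ ‖C + t • U + t ^ 2 • W‖ ≤ 1 := by
    intro t
    rw [← sq_le_one_iff₀ (norm_nonneg _), hn, hR, sub_nonpos]
  have heq : ∀ t, R t = 0 → ‖C + t • U + t ^ 2 • W‖ = 1 := by
    intro t h
    rw [← sq_eq_sq₀ (norm_nonneg _) zero_le_one, hn]
    simp only [hR] at h
    linarith
  have hsub : ∀ K : Set ℝ, (∀ t, R t ≤ 0 → t ∈ K) →
      {z : Plane | z ∈ disc ∧ z 1 = γ + β * z 0 + α * z 0 ^ 2} ⊆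
        (fun t : ℝ => C + t • U + t ^ 2 • W) '' K := by
    rintro K hK z ⟨hz, hz'⟩
    have e : C + z 0 • U + z 0 ^ 2 • W = z := plane_ext (hz0 _) ((hz1 _).trans hz'.symm)
    exact ⟨z 0, hK _ ((hle _).2 (by rw [e]; exact mem_disc_iff.1 hz)), e⟩
  have hq : 0 < |α| := abs_pos.2 hα
  rcases quartic_nonpos_cases (R := R) (A := α ^ 2) (B := 2 * α * β) (C := 1 + β ^ 2 + 2 * α * γ)
      (D := 2 * β * γ) (E := γ ^ 2 - 1) (by positivity) (fun t => by simp only [hR]; ring) with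
    hpos | ⟨t₁, t₂, h12, e1, e2, hiff⟩ | ⟨t₁, t₂, t₃, t₄, h12, h23, h34, hfac⟩
  · refine (measure_mono (hsub ∅ fun t ht => absurd (hpos t) (not_lt.2 ht))).trans_lt ?_
    rw [Set.image_empty, measure_empty]
    exact ENNReal.ofReal_pos.2 (by norm_num)
  · refine (measure_mono (hsub _ fun t => (hiff t).1)).trans_lt ?_
    refine length_parabola_arc_lt h12 (heq _ e1) (heq _ e2)
      (fun t ht => (hle t).1 ((hiff t).2 ht)) fun h h' => h.ne ?_
    rw [← hz0 t₁, ← hz0 t₂, h']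
  · have hsub' := hsub (Set.Icc t₁ t₂ ∪ Set.Icc t₃ t₄) fun t ht =>
      mem_of_prod_nonpos h12 h23 h34 (by
        rw [hfac] at ht
        by_contra! h
        exact absurd ht (not_le.2 (mul_pos (by positivity) h)))
    rw [Set.image_union] at hsub'
    refine ((measure_mono hsub').trans (measure_union_le _ _)).trans_lt ?_
    have harc : ∀ a b : ℝ, a ≤ b → μH[1] ((fun t : ℝ => C + t • U + t ^ 2 • W) '' Set.Icc a b) ≤
        ENNReal.ofReal (∫ t in (a + β / (2 * α))..(b + β / (2 * α)),
          √(1 ^ 2 + (2 * |α| * t) ^ 2)) := by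
      intro a b hab
      refine (hausdorffMeasure_image_Icc_le_integral (γ' := fun t => U + (2 * t) • W) hab
        (fun t _ => ?_) (Continuous.continuousOn (by fun_prop))).trans (le_of_eq ?_)
      · have d1 : HasDerivAt (fun t : ℝ => t • U) U t := by
          simpa using (hasDerivAt_id t).smul_const U
        have d2 : HasDerivAt (fun t : ℝ => t ^ 2 • W) ((2 * t) • W) t := by
          simpa using (hasDerivAt_pow 2 t).smul_const W
        exact (d1.const_add C).add d2
      · rw [← intervalIntegral.integral_comp_add_right
          (fun t => √(1 ^ 2 + (2 * |α| * t) ^ 2))]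
        congr 2
        ext t
        rw [← Real.sqrt_sq (norm_nonneg _), norm_sq_plane]
        congr 1
        rw [mul_pow, mul_pow, sq_abs]
        simp [hU, hW]
        field_simp
        ring
    refine (add_le_add (harc _ _ h12) (harc _ _ h34)).trans_lt ?_
    rw [← ENNReal.ofReal_add
      (intervalIntegral.integral_nonneg (by linarith) fun _ _ => Real.sqrt_nonneg _)
      (intervalIntegral.integral_nonneg (by linarith) fun _ _ => Real.sqrt_nonneg _),
      ENNReal.ofReal_lt_ofReal_iff (by norm_num)]
    obtain ⟨σ, hσ, hσα⟩ : ∃ σ : ℝ, σ ^ 2 = 1 ∧ |α| = σ * α := by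
      rcases abs_choice α with h | h
      · exact ⟨1, by norm_num, by rw [h, one_mul]⟩
      · exact ⟨-1, by norm_num, by rw [h]; ring⟩
    -- The sign `σ` turns the parabola upwards, and the shift by `β / (2 * α)` moves its vertex to
    -- the origin.
    refine integral_sqrt_add_integral_sqrt_lt (h := -σ * (γ - β ^ 2 / (4 * α)))
      (k := β / (2 * α)) one_pos hq (by linarith) (by linarith) (by linarith) fun y => ?_
    obtain ⟨t, rfl⟩ : ∃ t, y = t + β / (2 * α) := ⟨y - β / (2 * α), by ring⟩
    have h := hfac t
    simp only [hR] at h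
    have e : |α| * (t + β / (2 * α)) ^ 2 - -σ * (γ - β ^ 2 / (4 * α)) =
        σ * (γ + β * t + α * t ^ 2) := by
      rw [hσα]
      field_simp
      ring
    rw [e, sq_abs]
    linear_combination h + (γ + β * t + α * t ^ 2) ^ 2 * hσ

/-- A chord of the unit disc. -/
theorem length_line_le {a b c : ℝ} (h : b ≠ 0 ∨ c ≠ 0) :
    length {z : Plane | z ∈ disc ∧ a + b * z 0 + c * z 1 = 0} ≤ 2 := by
  have hN : 0 < b ^ 2 + c ^ 2 := by
    rcases h with h | h <;> positivity
  obtain ⟨N, hNdef⟩ : ∃ N, N = √(b ^ 2 + c ^ 2) := ⟨_, rfl⟩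
  have hN0 : 0 < N := by rw [hNdef]; exact Real.sqrt_pos.2 hN
  have hN2 : N ^ 2 = b ^ 2 + c ^ 2 := by rw [hNdef]; exact Real.sq_sqrt hN.le
  obtain ⟨z₀, hz₀⟩ : ∃ z₀ : Plane, z₀ = !₂[-a * b / N ^ 2, -a * c / N ^ 2] := ⟨_, rfl⟩
  obtain ⟨u, hu⟩ : ∃ u : Plane, u = !₂[-c / N, b / N] := ⟨_, rfl⟩
  have hu1 : ‖u‖ = 1 := by
    rw [← sq_eq_sq₀ (norm_nonneg _) zero_le_one, norm_sq_plane, hu]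
    simp
    field_simp
    linarith
  have hmeas := hausdorffMeasure_image_Icc_le (γ := fun t : ℝ => z₀ + t • u) (φ := fun t => t)
    (a := -1) (b := 1) (by
      intro s _ t _ hst
      rw [dist_comm, dist_eq_norm, add_sub_add_left_eq_sub, ← sub_smul, norm_smul, hu1, mul_one,
        Real.norm_of_nonneg (by linarith)])
  refine (measure_mono ?_).trans (hmeas.trans (by norm_num))
  rintro z ⟨hz, hz'⟩
  have hzn : z 0 ^ 2 + z 1 ^ 2 ≤ 1 := by
    rw [← norm_sq_plane]
    exact pow_le_one₀ (norm_nonneg _) (mem_disc_iff.1 hz)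
  have ht : |(-c * z 0 + b * z 1) / N| ≤ 1 := by
    rw [abs_le_one_iff_mul_self_le_one, div_mul_div_comm, div_le_one (by positivity)]
    nlinarith [sq_nonneg (b * z 0 + c * z 1)]
  refine ⟨(-c * z 0 + b * z 1) / N, abs_le.1 ht, plane_ext ?_ ?_⟩
  · rw [hz₀, hu]
    simp
    field_simp
    rw [hN2]
    linear_combination -b * hz'
  · rw [hz₀, hu]
    simp
    field_simp
    rw [hN2]
    linear_combination -c * hz'

theorem ofReal_four_lt : (2 : ℝ≥0∞) + 2 < ENNReal.ofReal 4.002671 := by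
  rw [show (2 : ℝ≥0∞) + 2 = ENNReal.ofReal 4 by norm_num,
    ENNReal.ofReal_lt_ofReal_iff (by norm_num)]
  norm_num

theorem length_lt_of_subset_lines {S : Set Plane} {a b c a' b' c' : ℝ} (h : b ≠ 0 ∨ c ≠ 0)
    (h' : b' ≠ 0 ∨ c' ≠ 0) (hS : ∀ z ∈ S, z ∈ disc ∧
      (a + b * z 0 + c * z 1 = 0 ∨ a' + b' * z 0 + c' * z 1 = 0)) :
    length S < ENNReal.ofReal 4.002671 := by
  refine lt_of_le_of_lt ?_ ofReal_four_lt
  refine le_trans (measure_mono (t := {z : Plane | z ∈ disc ∧ a + b * z 0 + c * z 1 = 0} ∪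
    {z : Plane | z ∈ disc ∧ a' + b' * z 0 + c' * z 1 = 0}) fun z hz => ?_)
    ((measure_union_le _ _).trans (add_le_add (length_line_le h) (length_line_le h')))
  rcases hS z hz with ⟨h1, h2 | h2⟩
  · exact Or.inl ⟨h1, h2⟩
  · exact Or.inr ⟨h1, h2⟩

theorem length_variety_lt {Q : Plane → ℝ} {a b c d e : ℝ}
    (hQ : ∀ z, Q z = a + b * z 0 + c * z 1 + d * z 0 ^ 2 + e * (z 0 * z 1)) (h0 : Q ≠ 0) :
    length (variety Q) < ENNReal.ofReal 4.002671 := by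
  have hempty : (∀ z, Q z ≠ 0) → length (variety Q) < ENNReal.ofReal 4.002671 := by
    intro h
    have : variety Q = ∅ := Set.eq_empty_of_forall_notMem fun z hz => h z hz.2
    rw [this, length, measure_empty]
    exact ENNReal.ofReal_pos.2 (by norm_num)
  by_cases he : e = 0
  · subst he
    by_cases hc : c = 0
    · subst hc
      by_cases hd : d = 0
      · subst hd
        by_cases hb : b = 0
        · subst hb
          refine hempty fun z hz => h0 (funext fun w => ?_)
          rw [hQ] at hz ⊢
          simpa using hz
        · refine length_lt_of_subset_lines (a := a) (a' := a) (c := 0) (c' := 0)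
            (Or.inl hb) (Or.inl hb) fun z hz => ⟨hz.1, Or.inl ?_⟩
          have := hz.2
          rw [hQ] at this
          linarith
      · by_cases hdisc : 0 ≤ b ^ 2 - 4 * d * a
        · have hs := Real.sq_sqrt hdisc
          refine length_lt_of_subset_lines (a := b - √(b ^ 2 - 4 * d * a)) (b := 2 * d) (c := 0)
            (a' := b + √(b ^ 2 - 4 * d * a)) (b' := 2 * d) (c' := 0)
            (Or.inl (by positivity)) (Or.inl (by positivity)) fun z hz => ⟨hz.1, ?_⟩
          have := hz.2
          rw [hQ] at this
          rw [← mul_eq_zero]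
          linear_combination 4 * d * this - hs
        · refine hempty fun z hz => hdisc ?_
          rw [hQ] at hz
          have : b ^ 2 - 4 * d * a = (2 * d * z 0 + b) ^ 2 := by linear_combination -4 * d * hz
          rw [this]
          positivity
    · by_cases hd : d = 0
      · subst hd
        refine length_lt_of_subset_lines (a := a) (a' := a) (b := b) (b' := b)
          (Or.inr hc) (Or.inr hc) fun z hz => ⟨hz.1, Or.inl ?_⟩
        have := hz.2
        rw [hQ] at this
        linarith
      · refine (measure_mono fun z hz => ?_).trans_lt
          (length_parabola_lt (α := -d / c) (β := -b / c) (γ := -a / c)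
            (div_ne_zero (neg_ne_zero.2 hd) hc))
        refine ⟨hz.1, ?_⟩
        have := hz.2
        rw [hQ] at this
        field_simp
        linarith
  · obtain ⟨x₀, hx₀⟩ : ∃ x₀, x₀ = -c / e := ⟨_, rfl⟩
    have hc : c = -e * x₀ := by rw [hx₀]; field_simp
    obtain ⟨s, hs⟩ : ∃ s, s = a + b * x₀ + d * x₀ ^ 2 := ⟨_, rfl⟩
    obtain ⟨b', hb'⟩ : ∃ b', b' = b + 2 * d * x₀ := ⟨_, rfl⟩
    -- The two linear factors are the asymptotes, one of them vertical. For `s = 0` they are the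
    -- conic itself; otherwise `t = z 0 - x₀` parametrizes the hyperbola.
    have hQ' : ∀ z, Q z = (z 0 - x₀) * (e * z 1 + b' + d * (z 0 - x₀)) + s := by
      intro z
      rw [hQ, hs, hb', hc]
      ring
    by_cases hs0 : s = 0
    · refine length_lt_of_subset_lines (a := -x₀) (b := 1) (c := 0) (a' := b' - d * x₀) (b' := d)
        (c' := e) (Or.inl one_ne_zero) (Or.inr he) fun z hz => ⟨hz.1, ?_⟩
      have := hz.2
      rw [hQ', hs0] at this
      rw [← mul_eq_zero]
      linear_combination this
    · obtain ⟨C, hC⟩ : ∃ C : Plane, C = !₂[x₀, -b' / e] := ⟨_, rfl⟩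
      obtain ⟨U, hU⟩ : ∃ U : Plane, U = !₂[1, -d / e] := ⟨_, rfl⟩
      obtain ⟨W, hW⟩ : ∃ W : Plane, W = !₂[0, -s / e] := ⟨_, rfl⟩
      have hU0 : U 0 = 1 := by simp [hU]
      have hW0 : W 0 = 0 := by simp [hW]
      have hW1 : W 1 = -s / e := by simp [hW]
      refine (measure_mono fun z hz => ?_).trans_lt
        (length_hyperbola_lt (C := C) (U := U) (W := W) ?_ ?_)
      · refine ⟨mem_disc_iff.1 hz.1, z 0 - x₀, ?_, ?_⟩
        · intro h
          have := hz.2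
          rw [hQ', h] at this
          exact hs0 (by linarith)
        · have h1 : z 0 - x₀ ≠ 0 := by
            intro h
            have := hz.2
            rw [hQ', h] at this
            exact hs0 (by linarith)
          have h2 := hz.2
          rw [hQ'] at h2
          refine plane_ext ?_ ?_
          · simp [hC, hU, hW]
          · simp [hC, hU, hW]
            field_simp
            linear_combination h2
      · intro h
        rw [h] at hU0
        simp at hU0
      · intro r h
        have h1 : W 0 = r * U 0 := by rw [h]; simp
        have h2 : W 1 = r * U 1 := by rw [h]; simp
        rw [hW0, hU0, mul_one] at h1
        rw [← h1, zero_mul, hW1] at h2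
        exact div_ne_zero (neg_ne_zero.2 hs0) he h2

/-! ### Low degree and mass -/

theorem exists_coeffs_linear {p : ℕ} (hp : p ≤ 2) {Q : Plane → ℝ} (hQ : Q ∈ polySpace p) :
    ∃ a b c : ℝ, ∀ z : Plane, Q z = a + b * z 0 + c * z 1 := by
  induction hQ using Submodule.span_induction with
  | mem f hf =>
    rcases hf with hf | ⟨i, hi, hf⟩
    · rw [Set.mem_singleton_iff] at hf
      exact ⟨1, 0, 0, fun z => by simp [hf]⟩
    · subst hf
      fin_cases i
      · exact ⟨0, 1, 0, fun z => by simp [monomial]⟩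
      · exact ⟨0, 0, 1, fun z => by simp [monomial]⟩
      · simp at hi; omega
      · simp at hi; omega
  | zero => exact ⟨0, 0, 0, fun z => by simp⟩
  | add f g _ _ hf hg =>
    obtain ⟨a, b, c, h⟩ := hf
    obtain ⟨a', b', c', h'⟩ := hg
    exact ⟨a + a', b + b', c + c', fun z => by rw [Pi.add_apply, h, h']; ring⟩
  | smul t f _ hf =>
    obtain ⟨a, b, c, h⟩ := hf
    exact ⟨t * a, t * b, t * c, fun z => by rw [Pi.smul_apply, h, smul_eq_mul]; ring⟩

theorem length_variety_le_two {Q : Plane → ℝ} {a b c : ℝ}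
    (hQ : ∀ z, Q z = a + b * z 0 + c * z 1) (h0 : Q ≠ 0) : length (variety Q) ≤ 2 := by
  by_cases h : b ≠ 0 ∨ c ≠ 0
  · refine (measure_mono fun z hz => ?_).trans (length_line_le (a := a) h)
    exact ⟨hz.1, by rw [← hQ]; exact hz.2⟩
  · push Not at h
    obtain ⟨rfl, rfl⟩ := h
    have : variety Q = ∅ := by
      refine Set.eq_empty_of_forall_notMem fun z hz => h0 (funext fun w => ?_)
      have := hz.2
      rw [hQ] at this ⊢
      simpa using this
    rw [this, length, measure_empty]
    exact zero_le

theorem hasDensityZero_of_eventually_notMem {E : Set Plane} {z : Plane}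
    (h : ∀ᶠ w in 𝓝 z, w ∉ E) : HasDensityZero E z := by
  obtain ⟨ε, hε, hball⟩ := Metric.eventually_nhds_iff_ball.1 h
  refine tendsto_const_nhds.congr' ?_
  filter_upwards [Ioo_mem_nhdsGT hε] with r hr
  have : E ∩ Metric.ball z r = ∅ := Set.eq_empty_of_forall_notMem fun w hw =>
    hball w (Metric.ball_subset_ball hr.2.le hw.2) hw.1
  rw [ballRatio, this, measure_empty, ENNReal.zero_div]

/-- Off the zero set the sign of `Q` is locally constant, so the region or its complement misses a
neighbourhood. -/
theorem essBoundary_subset_zeros {Q : Plane → ℝ} (hQ : Continuous Q) :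
    essBoundary {z | Q z < 0} ⊆ {z | Q z = 0} := by
  rintro z ⟨h1, h2⟩
  by_contra h
  rcases lt_or_gt_of_ne h with h | h
  · refine h2 (hasDensityZero_of_eventually_notMem ?_)
    filter_upwards [hQ.continuousAt.eventually_lt continuousAt_const h] with w hw hw'
    exact hw' hw
  · refine h1 (hasDensityZero_of_eventually_notMem ?_)
    filter_upwards [continuousAt_const.eventually_lt hQ.continuousAt h] with w hw hw'
    exact lt_asymm hw hw'

theorem mass_F_le {p : ℕ} (Q : polySpace p) (hQ : Q ≠ 0) :
    (F p (Projectivization.mk ℝ Q hQ)).mass ≤ length (variety Q) := by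
  refine measure_mono fun z hz => ?_
  exact ⟨Metric.ball_subset_closedBall hz.2,
    essBoundary_subset_zeros (continuous_of_mem Q.2) hz.1⟩

end GuthSweepout

theorem lemma4p2 :
    (∀ p : ℕ, p = 1 ∨ p = 2 →
      ∀ (Q : GuthSweepout.polySpace p) (hQ : Q ≠ 0),
        (GuthSweepout.F p (Projectivization.mk ℝ Q hQ)).mass ≤ 2 ∧
        GuthSweepout.length (GuthSweepout.variety Q) ≤ 2) ∧
    (∀ p : ℕ, p = 3 ∨ p = 4 →
      ∀ (Q : GuthSweepout.polySpace p) (hQ : Q ≠ 0),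
        (GuthSweepout.F p (Projectivization.mk ℝ Q hQ)).mass < ENNReal.ofReal 4.002671 ∧
        GuthSweepout.length (GuthSweepout.variety Q) < ENNReal.ofReal 4.002671) := by
  refine ⟨fun p hp Q hQ => ?_, fun p _ Q hQ => ?_⟩
  · obtain ⟨a, b, c, h⟩ := GuthSweepout.exists_coeffs_linear (by omega) Q.2
    have := GuthSweepout.length_variety_le_two h fun h => hQ (Subtype.ext h)
    exact ⟨(GuthSweepout.mass_F_le Q hQ).trans this, this⟩
  · obtain ⟨a, b, c, d, e, h⟩ := GuthSweepout.exists_coeffs Q.2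
    have := GuthSweepout.length_variety_lt h fun h => hQ (Subtype.ext h)
    exact ⟨(GuthSweepout.mass_F_le Q hQ).trans_lt this, this⟩
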